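/- Let $X=(X_t)_{t\ge1}$ be a real Gaussian sequence with mean $m_t=\mathbb E X_t$ and covariance $K(t,s)=\mathbb E (X_t-m_t)(X_s-m_s)$, let $(A_t)_{t\ge1}$ be real numbers, and let $Y_t=A_tX_t+\varepsilon_t$, $t\ge1$, where $(\varepsilon_t)_{t\ge 1}$ are i.i.d. $\mathcal N(0,1)$ and independent of $X$. Put $\mathcal Y_t=\sigma(Y_u:1\le u\le t)$, and let $\mu\in\mathbb R$, $Q_t\ge0$ and a horizon $T$ be given; let $S_l=A_l^2-\mu Q_l$. Assume condition $(C_\mu)$: the equation $$\overline\gamma(t,s)=K(t,s)-\sum_{l=1}^{s-1}\overline\gamma(t,l)\,\overline\gamma(s,l)\,\frac{S_l}{1+S_l\overline\gamma_l},\qquad \overline\gamma_l=\overline\gamma(l,l),$$ has a unique and bounded solution on $\{(t,s):1\le s\le t\le T\}$, and it satisfies $\overline\gamma_l\ge0$ and $1+S_l\overline\gamma_l>0$ for $1\le l\le T$. Then the recursion $$\overline h_t=m_t+\sum_{l=1}^tA_l\,\overline\gamma(t,l)\,(Y_l-A_l\overline h_l),\qquad 1\le t\le T,$$ has a unique solution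 $\overline h$. It solves the LEG filtering problem, i.e. it minimizes $\mathbb E\big[\mu\exp\{\frac\mu2\sum_{t=1}^T(X_t-h_t)^2Q_t\}\big]$ among all $h=(h_t)_{1\le t\le T}$ with $h_t$ being $\mathcal Y_t$-measurable, and it solves the risk-sensitive (RS) filtering problem, i.e. for every $1\le t\le T$ the variable $\overline h_t$ is $\mathcal Y_t$-measurable and, almost surely, minimizes $$\mathbb E\Big[\mu\exp\Big\{\frac\mu2(X_t-g)^2Q_t+\frac\mu2\sum_{s=1}^{t-1}(X_s-\overline h_s)^2Q_s\Big\}\Big|\,\mathcal Y_t\Big]$$ among all $\mathcal Y_t$-measurable random variables $g$. (For $\mu>0$ the expectations and conditional expectations may take the value $+\infty$.) Hence the LEG and RS filtering problems have the same solution: a sequence $h$ solves one if and only if it solves the other, and every solution $h$ satisfies $h_t=\overline h_t$ almost surely for every $t\le T$ with $\mu Q_t\neq0$. -/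

import Mathlib

open MeasureTheory ProbabilityTheory
open scoped ENNReal

/- Time is a natural number `t ≥ 1`; values of sequences at index `0` are never used. -/

namespace RiskFilter

/-- The observation process `Y_t = A_t X_t + ε_t`. -/
def obs {Ω : Type*} (A : ℕ → ℝ) (X ε : ℕ → Ω → ℝ) (t : ℕ) (ω : Ω) : ℝ :=
  A t * X t ω + ε t ω

/-- The σ-field `σ(Y_u : 1 ≤ u ≤ t)` of the observations up to time `t`. -/
@[reducible]
def obsField {Ω : Type*} (Y : ℕ → Ω → ℝ) (t : ℕ) : MeasurableSpace Ω :=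
  ⨆ u ∈ Set.Icc 1 t, MeasurableSpace.comap (Y u) (borel ℝ)

/-- The signal-observation model: `X = (X_t)_{t ≥ 1}` is a Gaussian sequence with mean `m` and
covariance `K`, `ε = (ε_t)_{t ≥ 1}` is i.i.d. `𝒩(0,1)`, and the two sequences are independent. -/
structure IsSignalModel {Ω : Type*} [MeasurableSpace Ω] (P : Measure Ω)
    (X ε : ℕ → Ω → ℝ) (m : ℕ → ℝ) (K : ℕ → ℕ → ℝ) : Prop where
  measurable_signal : ∀ t, 1 ≤ t → Measurable (X t)
  measurable_noise : ∀ t, 1 ≤ t → Measurable (ε t)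
  gaussian_signal : IsGaussianProcess (fun t : ℕ => X (t + 1)) P
  mean_signal : ∀ t, 1 ≤ t → ∫ ω, X t ω ∂P = m t
  cov_signal : ∀ t s, 1 ≤ t → 1 ≤ s → cov[X t, X s; P] = K t s
  law_noise : ∀ t, 1 ≤ t → HasLaw (ε t) (gaussianReal 0 1) P
  indep_noise : iIndepFun (fun t : ℕ => ε (t + 1)) P
  indep_signal_noise :
    IndepFun (fun ω => fun t : ℕ => X (t + 1) ω) (fun ω => fun t : ℕ => ε (t + 1) ω) P

/-- `S_l = A_l² - μ Q_l`. -/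
def weight (A Q : ℕ → ℝ) (μ : ℝ) (l : ℕ) : ℝ := A l ^ 2 - μ * Q l

/-- `γ` solves, for `1 ≤ s ≤ t ≤ T`, the Volterra type equation
`γ(t,s) = K(t,s) - ∑_{l=1}^{s-1} γ(t,l) γ(s,l) S_l / (1 + S_l γ(l,l))`,
all denominators occurring in it being nonzero. -/
def IsGammaSolution (K : ℕ → ℕ → ℝ) (A Q : ℕ → ℝ) (μ : ℝ) (T : ℕ) (γ : ℕ → ℕ → ℝ) : Prop :=
  (∀ l, 1 ≤ l → l < T → 1 + weight A Q μ l * γ l l ≠ 0) ∧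
  ∀ t s, 1 ≤ s → s ≤ t → t ≤ T →
    γ t s = K t s - ∑ l ∈ Finset.Ico 1 s,
      γ t l * γ s l * (weight A Q μ l / (1 + weight A Q μ l * γ l l))

/-- The condition `(C_μ)`: the equation for `γ` has a unique and bounded solution on
`{(t,s) : 1 ≤ s ≤ t ≤ T}`, with `γ(l,l) ≥ 0` and `1 + S_l γ(l,l) > 0`. -/
def ConditionC (K : ℕ → ℕ → ℝ) (A Q : ℕ → ℝ) (μ : ℝ) (T : ℕ) : Prop :=
  ∃ γ : ℕ → ℕ → ℝ, IsGammaSolution K A Q μ T γ ∧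
    (∀ γ' : ℕ → ℕ → ℝ, IsGammaSolution K A Q μ T γ' →
      ∀ t s, 1 ≤ s → s ≤ t → t ≤ T → γ' t s = γ t s) ∧
    (∃ C : ℝ, ∀ t s, 1 ≤ s → s ≤ t → t ≤ T → |γ t s| ≤ C) ∧
    (∀ l, 1 ≤ l → l ≤ T → 0 ≤ γ l l) ∧
    (∀ l, 1 ≤ l → l ≤ T → 0 < 1 + weight A Q μ l * γ l l)

/-- `h` solves `h_t = m_t + ∑_{l=1}^t A_l γ(t,l) (Y_l - A_l h_l)` for `1 ≤ t ≤ T`. -/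
def IsFilterSolution {Ω : Type*} (m A : ℕ → ℝ) (γ : ℕ → ℕ → ℝ) (Y : ℕ → Ω → ℝ) (T : ℕ)
    (h : ℕ → Ω → ℝ) : Prop :=
  ∀ t, 1 ≤ t → t ≤ T → ∀ ω,
    h t ω = m t + ∑ l ∈ Finset.Icc 1 t, A l * γ t l * (Y l ω - A l * h l ω)

/-- `h_t` is measurable with respect to `σ(Y_u : 1 ≤ u ≤ t)` for `1 ≤ t ≤ T`. -/
def IsObsAdapted {Ω : Type*} (Y : ℕ → Ω → ℝ) (T : ℕ) (h : ℕ → Ω → ℝ) : Prop :=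
  ∀ t, 1 ≤ t → t ≤ T → Measurable[obsField Y t] (h t)

/-- Extended expectation `E F⁺ - E F⁻`, for random variables `F` of constant sign
(values `±∞` allowed). -/
noncomputable def extExp {Ω : Type*} [MeasurableSpace Ω] (P : Measure Ω) (F : Ω → ℝ) : EReal :=
  ((∫⁻ ω, ENNReal.ofReal (F ω) ∂P : ℝ≥0∞) : EReal) -
    ((∫⁻ ω, ENNReal.ofReal (-F ω) ∂P : ℝ≥0∞) : EReal)

/-- Extended conditional expectation `E[F⁺ | 𝓖] - E[F⁻ | 𝓖]`, for random variables `F` of constant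
sign (values `±∞` allowed). -/
noncomputable def extCondExp {Ω : Type*} [MeasurableSpace Ω] (P : Measure Ω)
    (𝓖 : MeasurableSpace Ω) (F : Ω → ℝ) (ω : Ω) : EReal :=
  ((condLExp 𝓖 P (fun ω' => ENNReal.ofReal (F ω')) ω : ℝ≥0∞) : EReal) -
    ((condLExp 𝓖 P (fun ω' => ENNReal.ofReal (-F ω')) ω : ℝ≥0∞) : EReal)

/-- The LEG criterion `E [μ exp {(μ/2) ∑_{t=1}^T (X_t - h_t)² Q_t}]`. -/
noncomputable def legCost {Ω : Type*} [MeasurableSpace Ω] (P : Measure Ω) (X : ℕ → Ω → ℝ)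
    (Q : ℕ → ℝ) (μ : ℝ) (T : ℕ) (h : ℕ → Ω → ℝ) : EReal :=
  extExp P (fun ω =>
    μ * Real.exp (μ / 2 * ∑ t ∈ Finset.Icc 1 T, (X t ω - h t ω) ^ 2 * Q t))

/-- `h` solves the LEG filtering problem: it minimizes the LEG criterion among all sequences with
`h_t` measurable with respect to `σ(Y_u : 1 ≤ u ≤ t)`. -/
def IsLEGSolution {Ω : Type*} [MeasurableSpace Ω] (P : Measure Ω) (X Y : ℕ → Ω → ℝ)
    (Q : ℕ → ℝ) (μ : ℝ) (T : ℕ) (h : ℕ → Ω → ℝ) : Prop :=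
  IsObsAdapted Y T h ∧
    ∀ h' : ℕ → Ω → ℝ, IsObsAdapted Y T h' → legCost P X Q μ T h ≤ legCost P X Q μ T h'

/-- The conditional criterion
`E [μ exp {(μ/2) (X_t - g)² Q_t + (μ/2) ∑_{s=1}^{t-1} (X_s - h_s)² Q_s} | σ(Y_u : 1 ≤ u ≤ t)]`. -/
noncomputable def rsCost {Ω : Type*} [MeasurableSpace Ω] (P : Measure Ω) (X Y : ℕ → Ω → ℝ)
    (Q : ℕ → ℝ) (μ : ℝ) (h : ℕ → Ω → ℝ) (t : ℕ) (g : Ω → ℝ) : Ω → EReal :=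
  extCondExp P (obsField Y t) (fun ω =>
    μ * Real.exp (μ / 2 * (X t ω - g ω) ^ 2 * Q t +
      μ / 2 * ∑ s ∈ Finset.Ico 1 t, (X s ω - h s ω) ^ 2 * Q s))

/-- `h` solves the risk-sensitive filtering problem: recursively, for every `1 ≤ t ≤ T`, given
`h_1, …, h_{t-1}`, the random variable `h_t` minimizes (almost surely) the conditional criterion
among all random variables `g` measurable with respect to `σ(Y_u : 1 ≤ u ≤ t)`. -/
def IsRSSolution {Ω : Type*} [MeasurableSpace Ω] (P : Measure Ω) (X Y : ℕ → Ω → ℝ)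
    (Q : ℕ → ℝ) (μ : ℝ) (T : ℕ) (h : ℕ → Ω → ℝ) : Prop :=
  ∀ t, 1 ≤ t → t ≤ T → Measurable[obsField Y t] (h t) ∧
    ∀ g : Ω → ℝ, Measurable[obsField Y t] g →
      ∀ᵐ ω ∂P, rsCost P X Y Q μ h t (h t) ω ≤ rsCost P X Y Q μ h t g ω

end RiskFilter

/-! Girsanov's theorem (`map_refMeasure`) gives an equivalent measure under which the observations
up to the horizon are i.i.d. standard Gaussian and independent of the signal, whose law is
unchanged. As h_t is a function of Y_1, …, Y_t, the signal can then be integrated out with Y and h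
frozen. Apart from a factor in h alone, the integrand is the exponential of ∑ (-(S_t/2) X_t² + b_t
X_t) with b_t = A_t Y_t - μ Q_t h_t. Tilting one coordinate at a time changes the covariance of the
remaining ones by a rank-one term, and the equation for γ records exactly these updates
(`lintegral_exp_quadratic_of_lintegral_exp_linear`).

Completing the square in h_t (`tilt_exponent_eq`) splits the exponent into a log-likelihood and a
loss, a combination of squares (h_t - `riskEstimate`)² whose weights have the sign of μ or vanish.
The likelihood depends on h only through predictable means, so its integral is a finite constant,
the same for every adapted h (`lintegral_exp_sum_logLik`). Hence zero loss is optimal, and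
optimality forces zero loss almost everywhere. Although `riskEstimate` depends on the earlier h_l,
the filtering recursion makes h_t equal to it at every t (`update_coeff_eq`,
`IsFilterSolution.eq_riskEstimate`).

The RS criterion at time t is the LEG criterion with horizon t, conditioned on the observations.
Pasting a competitor on an observable event localises LEG optimality to conditional optimality
(`rsCost_filter_le`). Conversely, integrating the RS inequalities and inducting on t reduces RS
uniqueness to LEG uniqueness. Both solution sets are thus the adapted sequences agreeing with the
filter almost surely where μ Q_t ≠ 0. -/

namespace RiskFilter

/-! ### One-dimensional Gaussian integrals and identification by exponential moments -/

/-- Exponential-quadratic tilting of a nondegenerate Gaussian density. -/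
lemma exp_quadratic_mul_gaussianPDFReal (α S b γ x : ℝ) (hγ : 0 < γ) (hS : 0 < 1 + S * γ) :
    Real.exp (-(S / 2) * x ^ 2 + b * x) * gaussianPDFReal α γ.toNNReal x =
      (√(1 + S * γ))⁻¹ * Real.exp ((-(S / 2) * α ^ 2 + b * α + γ / 2 * b ^ 2) / (1 + S * γ)) *
        gaussianPDFReal ((α + γ * b) / (1 + S * γ)) (γ / (1 + S * γ)).toNNReal x := by
  have h1 : ((γ.toNNReal : NNReal) : ℝ) = γ := Real.coe_toNNReal _ hγ.le
  have h2 : (((γ / (1 + S * γ)).toNNReal : NNReal) : ℝ) = γ / (1 + S * γ) :=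
    Real.coe_toNNReal _ (by positivity)
  have h3 : √(2 * Real.pi * γ) = √(1 + S * γ) * √(2 * Real.pi * (γ / (1 + S * γ))) := by
    rw [← Real.sqrt_mul hS.le]
    congr 1
    rw [mul_left_comm, mul_comm (1 + S * γ), div_mul_cancel₀ _ hS.ne']
  simp only [gaussianPDFReal, h1, h2]
  rw [h3, mul_inv, mul_left_comm, ← Real.exp_add]
  rw [show ∀ p q r s : ℝ, p * q * (r * s) = (p * r) * (q * s) from fun p q r s => by ring,
    ← Real.exp_add]
  congr 2
  have := hS.ne'
  rw [← sub_eq_zero]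
  field_simp
  ring

lemma lintegral_exp_quadratic_gaussianReal (α S b γ : ℝ) (hγ : 0 ≤ γ) (hS : 0 < 1 + S * γ) :
    ∫⁻ x, ENNReal.ofReal (Real.exp (-(S / 2) * x ^ 2 + b * x)) ∂(gaussianReal α γ.toNNReal) =
      ENNReal.ofReal ((√(1 + S * γ))⁻¹ *
        Real.exp ((-(S / 2) * α ^ 2 + b * α + γ / 2 * b ^ 2) / (1 + S * γ))) := by
  rcases hγ.eq_or_lt with rfl | hγ
  -- Zero variance is a Dirac mass; this case is needed because γ(l,l) may vanish.
  · simp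
  have h0 : γ.toNNReal ≠ 0 := by simpa using hγ
  have h1 : (γ / (1 + S * γ)).toNNReal ≠ 0 := by
    simp only [ne_eq, Real.toNNReal_eq_zero, not_le]; positivity
  rw [gaussianReal_of_var_ne_zero _ h0, lintegral_withDensity_eq_lintegral_mul _ (by fun_prop)
    (by fun_prop)]
  simp only [Pi.mul_apply, gaussianPDF]
  simp_rw [mul_comm (ENNReal.ofReal (gaussianPDFReal _ _ _)),
    ← ENNReal.ofReal_mul (Real.exp_nonneg _), exp_quadratic_mul_gaussianPDFReal _ _ _ _ _ hγ hS]
  simp_rw [ENNReal.ofReal_mul' (gaussianPDFReal_nonneg _ _ _)]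
  rw [lintegral_const_mul _ (by fun_prop), lintegral_gaussianPDFReal_eq_one _ h1, mul_one]

lemma mgf_eq_toReal_lintegral {Ω : Type*} [MeasurableSpace Ω] (P : Measure Ω) {X : Ω → ℝ}
    (hX : Measurable X) (s : ℝ) :
    mgf X P s = (∫⁻ ω, ENNReal.ofReal (Real.exp (s * X ω)) ∂P).toReal := by
  rw [mgf, integral_eq_lintegral_of_nonneg_ae (ae_of_all _ fun _ => (Real.exp_pos _).le)
    (by fun_prop)]

/-- A measure with Gaussian exponential moments is a multiple of a Gaussian measure. -/
lemma map_eq_smul_gaussianReal {Ω : Type*} [MeasurableSpace Ω] (P : Measure Ω) {X : Ω → ℝ}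
    (hX : Measurable X) (C α γ : ℝ) (hC : 0 < C) (hγ : 0 ≤ γ)
    (h : ∀ s, ∫⁻ ω, ENNReal.ofReal (Real.exp (s * X ω)) ∂P =
      ENNReal.ofReal (C * Real.exp (s * α + γ / 2 * s ^ 2))) :
    P.map X = ENNReal.ofReal C • gaussianReal α γ.toNNReal := by
  -- Total mass is the exponential moment at s = 0.
  have hP : P Set.univ = ENNReal.ofReal C := by simpa using h 0
  have : IsFiniteMeasure P := ⟨by rw [hP]; exact ENNReal.ofReal_lt_top⟩
  have hP0 : P ≠ 0 := by
    rintro rfl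
    simp only [Measure.coe_zero, Pi.zero_apply] at hP
    exact absurd hP.symm (by simpa using hC)
  set G : Measure ℝ := ENNReal.ofReal C • gaussianReal α γ.toNNReal with hG
  have : IsFiniteMeasure G := ⟨by simp [hG]⟩
  have hG0 : G ≠ 0 := by
    intro h0
    have := congrArg (fun m => m Set.univ) h0
    simp [hG] at this
    linarith
  have hmgf : mgf X P = mgf id G := by
    ext s
    rw [mgf_eq_toReal_lintegral P hX, h s, ENNReal.toReal_ofReal (by positivity), hG, mgf,
      integral_smul_measure, ENNReal.toReal_ofReal hC.le, ← mgf, mgf_id_gaussianReal,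
      Real.coe_toNNReal _ hγ, smul_eq_mul]
    ring_nf
  have hset : integrableExpSet X P = Set.univ := by
    ext s
    simp only [integrableExpSet, Set.mem_univ, iff_true]
    refine ⟨by fun_prop, ?_⟩
    rw [hasFiniteIntegral_iff_ofReal (ae_of_all _ fun _ => (Real.exp_pos _).le), h s]
    exact ENNReal.ofReal_lt_top
  -- All real exponential moments are finite, so equality on the real line continues analytically to
  -- the whole plane, and the complex transform determines the measure.
  have := eqOn_complexMGF_of_mgf' hmgf (by simp [hP0, hG0])
  rw [hset] at this
  rw [← Measure.map_id (μ := G)]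
  exact Measure.ext_of_complexMGF_eq hX.aemeasurable aemeasurable_id
    (funext fun z => this (by simp))

/-! ### Translation of Gaussian product measures -/

/-- One-dimensional translation formula for the standard Gaussian measure. -/
lemma setLIntegral_shift_gaussianReal (c : ℝ) {s : Set ℝ} (hs : MeasurableSet s) :
    ∫⁻ x, (s.indicator 1 (x + c)) * ENNReal.ofReal (Real.exp (-(c * x) - c ^ 2 / 2))
      ∂(gaussianReal 0 1) = gaussianReal 0 1 s := by
  have h : ∀ x, Real.exp (-(c * x) - c ^ 2 / 2) * gaussianPDFReal 0 1 x
      = gaussianPDFReal (-c) 1 x := by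
    intro x
    simp only [gaussianPDFReal]
    rw [mul_left_comm, ← Real.exp_add]
    congr 2
    simp
    ring
  have h2 : gaussianReal 0 1 s = (gaussianReal (-c) 1).map (· + c) s := by
    rw [gaussianReal_map_add_const]; simp
  have hms : Measurable fun x => s.indicator (1 : ℝ → ℝ≥0∞) (x + c) :=
    (measurable_one.indicator hs).comp (by fun_prop)
  rw [h2, ← lintegral_indicator_one hs, lintegral_map (measurable_one.indicator hs) (by fun_prop),
    gaussianReal_of_var_ne_zero _ one_ne_zero, gaussianReal_of_var_ne_zero _ one_ne_zero,
    lintegral_withDensity_eq_lintegral_mul _ (by fun_prop) (by fun_prop),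
    lintegral_withDensity_eq_lintegral_mul _ (by fun_prop) hms]
  refine lintegral_congr fun x => ?_
  simp only [Pi.mul_apply, gaussianPDF]
  rw [← h, ENNReal.ofReal_mul (Real.exp_nonneg _)]
  ring

/-- Translation formula for the standard Gaussian measure on `ℝ^ι`. -/
lemma lintegral_shift_pi_gaussianReal {ι : Type*} [Fintype ι] (c : ι → ℝ) {g : (ι → ℝ) → ℝ≥0∞}
    (hg : Measurable g) :
    ∫⁻ e, g (fun i => e i + c i) * ENNReal.ofReal (Real.exp (∑ i, (-(c i * e i) - c i ^ 2 / 2)))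
      ∂(Measure.pi fun _ : ι => gaussianReal 0 1) =
    ∫⁻ y, g y ∂(Measure.pi fun _ : ι => gaussianReal 0 1) := by
  set ν : Measure (ι → ℝ) := Measure.pi fun _ : ι => gaussianReal 0 1 with hν
  have hm : Measurable fun e : ι → ℝ => fun i => e i + c i := by fun_prop
  have hgm : Measurable fun e : ι → ℝ => g fun i => e i + c i := hg.comp hm
  -- Boxes determine the product measure, and on a box both the density and the indicator factor
  -- over coordinates.
  have key : ν = (ν.withDensity fun e => ENNReal.ofReal
      (Real.exp (∑ i, (-(c i * e i) - c i ^ 2 / 2)))).map (fun e i => e i + c i) := by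
    refine Measure.pi_eq fun s hs => ?_
    rw [Measure.map_apply hm (.univ_pi hs), withDensity_apply _ (hm (.univ_pi hs)),
      ← lintegral_indicator (hm (.univ_pi hs))]
    have : ∀ e : ι → ℝ, ((fun e : ι → ℝ => fun i => e i + c i) ⁻¹' Set.univ.pi s).indicator
        (fun e => ENNReal.ofReal (Real.exp (∑ i, (-(c i * e i) - c i ^ 2 / 2)))) e =
        ∏ i, ((s i).indicator 1 (e i + c i) *
          ENNReal.ofReal (Real.exp (-(c i * e i) - c i ^ 2 / 2))) := by
      intro e
      rw [Finset.prod_mul_distrib, ← ENNReal.ofReal_prod_of_nonneg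
        (fun _ _ => (Real.exp_pos _).le), ← Real.exp_sum]
      by_cases he : ∀ i, e i + c i ∈ s i
      · rw [Set.indicator_of_mem (by simpa using he), Finset.prod_congr rfl
          (fun i _ => Set.indicator_of_mem (he i) _)]
        simp
      · rw [Set.indicator_of_notMem (by simpa using he)]
        push Not at he
        obtain ⟨i, hi⟩ := he
        rw [Finset.prod_eq_zero (Finset.mem_univ i) (Set.indicator_of_notMem hi _), zero_mul]
    simp_rw [this]
    have hmi : ∀ i, Measurable fun x : ℝ => (s i).indicator (1 : ℝ → ℝ≥0∞) (x + c i) *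
          ENNReal.ofReal (Real.exp (-(c i * x) - c i ^ 2 / 2)) := fun i =>
      ((measurable_one.indicator (hs i)).comp (by fun_prop)).mul (by fun_prop)
    have hind : iIndepFun (fun (i : ι) (e : ι → ℝ) => (s i).indicator (1 : ℝ → ℝ≥0∞) (e i + c i) *
          ENNReal.ofReal (Real.exp (-(c i * e i) - c i ^ 2 / 2))) ν :=
      iIndepFun_pi (μ := fun _ : ι => gaussianReal 0 1) fun i => (hmi i).aemeasurable
    rw [lintegral_prod_eq_prod_lintegral_of_indepFun _ _ hind
      (fun i => (hmi i).comp (measurable_pi_apply i))]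
    refine Finset.prod_congr rfl fun i _ => ?_
    rw [← setLIntegral_shift_gaussianReal (c i) (hs i)]
    exact (measurePreserving_eval (fun _ : ι => gaussianReal 0 1) i).lintegral_comp (hmi i)
  conv_rhs => rw [key, lintegral_map hg hm, lintegral_withDensity_eq_lintegral_mul _ (by fun_prop)
    hgm]
  refine lintegral_congr fun e => ?_
  simp [mul_comm]

/-! ### Sequential tilting of the Gaussian signal -/

/-- The mean of the signal at time `t` after exponential-quadratic tilting by the coordinates at
times `1, …, t - 1`, with linear coefficients `b`. -/
noncomputable def predictor (m S : ℕ → ℝ) (γ : ℕ → ℕ → ℝ) (b : ℕ → ℝ) (t : ℕ) : ℝ :=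
  m t + ∑ l : Finset.Ico 1 t,
    γ t l * ((b l - S l * predictor m S γ b l) / (1 + S l * γ l l))
termination_by t
decreasing_by exact (Finset.mem_Ico.1 l.2).2

lemma predictor_eq (m S : ℕ → ℝ) (γ : ℕ → ℕ → ℝ) (b : ℕ → ℝ) (t : ℕ) :
    predictor m S γ b t = m t + ∑ l ∈ Finset.Ico 1 t,
      γ t l * ((b l - S l * predictor m S γ b l) / (1 + S l * γ l l)) := by
  rw [predictor]
  congr 1
  exact Finset.sum_coe_sort (Finset.Ico 1 t)
    fun l => γ t l * ((b l - S l * predictor m S γ b l) / (1 + S l * γ l l))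

/-- The only use of joint Gaussianity of the signal: later arguments need just these exponential
moments. -/
lemma lintegral_exp_linear_of_isSignalModel {Ω : Type*} [MeasurableSpace Ω] {P : Measure Ω}
    [IsProbabilityMeasure P] {X ε : ℕ → Ω → ℝ} {m : ℕ → ℝ} {K : ℕ → ℕ → ℝ}
    (hmodel : IsSignalModel P X ε m K) (N : ℕ) (v : ℕ → ℝ) :
    ∫⁻ ω, ENNReal.ofReal (Real.exp (∑ t ∈ Finset.Ico 1 (N + 1), v t * X t ω)) ∂P =
      ENNReal.ofReal (Real.exp (∑ t ∈ Finset.Ico 1 (N + 1), v t * m t +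
        1 / 2 * ∑ t ∈ Finset.Ico 1 (N + 1), ∑ s ∈ Finset.Ico 1 (N + 1), v t * v s * K t s)) := by
  set I := Finset.Ico 1 (N + 1) with hI
  have h1 : ∀ t ∈ I, 1 ≤ t := fun t ht => (Finset.mem_Ico.1 ht).1
  have hLaw : HasGaussianLaw (fun ω => ∑ t ∈ I, v t * X t ω) P := by
    have := (hmodel.gaussian_signal.smul fun t => v (t + 1)).hasGaussianLaw_fun_sum
      (I := Finset.range N)
    have hfun : (fun ω => ∑ t ∈ I, v t * X t ω) =
        fun ω => ∑ t ∈ Finset.range N, v (t + 1) • X (t + 1) ω := by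
      funext ω
      rw [Finset.range_eq_Ico]
      exact (Finset.sum_Ico_add' (fun t => v t * X t ω) 0 N 1).symm
    rw [hfun]
    exact this
  have hLp : ∀ t ∈ I, MemLp (X t) 2 P := by
    intro t ht
    obtain ⟨u, rfl⟩ := Nat.exists_eq_add_of_le' (h1 t ht)
    exact (hmodel.gaussian_signal.hasGaussianLaw_eval u).memLp_two
  have hZ : Measurable fun ω => ∑ t ∈ I, v t * X t ω :=
    Finset.measurable_fun_sum _ fun t ht => (hmodel.measurable_signal t (h1 t ht)).const_mul _
  have hmean : ∫ ω, ∑ t ∈ I, v t * X t ω ∂P = ∑ t ∈ I, v t * m t := by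
    rw [integral_finsetSum _ fun t ht => ((hLp t ht).integrable one_le_two).const_mul _]
    refine Finset.sum_congr rfl fun t ht => ?_
    rw [integral_const_mul, hmodel.mean_signal t (h1 t ht)]
  have hvar : Var[fun ω => ∑ t ∈ I, v t * X t ω; P] =
      ∑ t ∈ I, ∑ s ∈ I, v t * v s * K t s := by
    rw [← covariance_self hZ.aemeasurable, covariance_fun_sum_fun_sum'
      (fun t ht => (hLp t ht).const_mul _) (fun t ht => (hLp t ht).const_mul _)]
    refine Finset.sum_congr rfl fun t ht => Finset.sum_congr rfl fun s hs => ?_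
    rw [covariance_const_mul_left, covariance_const_mul_right,
      hmodel.cov_signal t s (h1 t ht) (h1 s hs)]
    ring
  -- With S = 0 and b = 1 the tilting formula is the Gaussian moment generating function at 1.
  have := lintegral_exp_quadratic_gaussianReal (∑ t ∈ I, v t * m t) 0 1
    (∑ t ∈ I, ∑ s ∈ I, v t * v s * K t s) (by rw [← hvar]; exact variance_nonneg _ _) (by simp)
  rw [← hvar, ← hmean, ← hLaw.map_eq_gaussianReal, lintegral_map (by fun_prop) hZ] at this
  simp only [hvar, hmean] at this
  convert this using 3
  · simp
  · simp; ring_nf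

/-- The exponential-quadratic moments of a Gaussian vector, tilted at the first coordinates. -/
lemma lintegral_exp_quadratic_of_lintegral_exp_linear {Ω : Type*} [MeasurableSpace Ω]
    {P : Measure Ω} {X : ℕ → Ω → ℝ} {m : ℕ → ℝ} {K γ : ℕ → ℕ → ℝ} {N : ℕ} {S : ℕ → ℝ}
    (hX : ∀ t, 1 ≤ t → Measurable (X t))
    (hmgf : ∀ v : ℕ → ℝ,
      ∫⁻ ω, ENNReal.ofReal (Real.exp (∑ t ∈ Finset.Ico 1 (N + 1), v t * X t ω)) ∂P =
      ENNReal.ofReal (Real.exp (∑ t ∈ Finset.Ico 1 (N + 1), v t * m t +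
        1 / 2 * ∑ t ∈ Finset.Ico 1 (N + 1), ∑ s ∈ Finset.Ico 1 (N + 1), v t * v s * K t s)))
    (hK : ∀ t s, 1 ≤ t → 1 ≤ s → K t s = K s t)
    (hγ : ∀ t s, 1 ≤ s → s ≤ t → t ≤ N →
      γ t s = K t s - ∑ l ∈ Finset.Ico 1 s, γ t l * γ s l * (S l / (1 + S l * γ l l)))
    (hγ0 : ∀ l, 1 ≤ l → l ≤ N → 0 ≤ γ l l) (hS : ∀ l, 1 ≤ l → l ≤ N → 0 < 1 + S l * γ l l)
    (b : ℕ → ℝ) {k : ℕ} (hk1 : 1 ≤ k) (hk : k ≤ N + 1) (v : ℕ → ℝ) :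
    ∫⁻ ω, ENNReal.ofReal (Real.exp (
        ∑ r ∈ Finset.Ico 1 k, (-(S r / 2) * X r ω ^ 2 + b r * X r ω) +
        ∑ t ∈ Finset.Ico k (N + 1), v t * X t ω)) ∂P =
      ENNReal.ofReal ((∏ r ∈ Finset.Ico 1 k, (√(1 + S r * γ r r))⁻¹) * Real.exp (
        ∑ r ∈ Finset.Ico 1 k, (-(S r / 2) * predictor m S γ b r ^ 2 + b r * predictor m S γ b r +
          γ r r / 2 * b r ^ 2) / (1 + S r * γ r r) +
        ∑ t ∈ Finset.Ico k (N + 1), v t * (m t + ∑ l ∈ Finset.Ico 1 k,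
          γ t l * ((b l - S l * predictor m S γ b l) / (1 + S l * γ l l))) +
        1 / 2 * ∑ t ∈ Finset.Ico k (N + 1), ∑ s ∈ Finset.Ico k (N + 1), v t * v s *
          (K t s - ∑ l ∈ Finset.Ico 1 k, γ t l * γ s l * (S l / (1 + S l * γ l l))))) := by
  -- The induction moves `X k` from the linear to the quadratic part; keeping `v` general makes the
  -- hypothesis a full description of the remaining coordinates.
  induction k, hk1 using Nat.le_induction generalizing v with
  | base => simpa using hmgf v
  | succ k hk1 ih =>
    have hkN : k < N + 1 := by omega
    have hk' : k ≤ N := by omega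
    set p := predictor m S γ b with hp
    set D := 1 + S k * γ k k with hD
    have hDpos : 0 < D := hS k hk1 hk'
    set J := Finset.Ico (k + 1) (N + 1) with hJ
    have hJk : ∀ t ∈ J, k < t ∧ t ≤ N := fun t ht => by
      rw [hJ, Finset.mem_Ico] at ht; omega
    -- `a` and `R` are the mean and covariance of the remaining coordinates after tilting by those
    -- before `k`. By the equation for γ, column `k` of `R` is γ(·,k).
    set a : ℕ → ℝ := fun t => m t + ∑ l ∈ Finset.Ico 1 k,
      γ t l * ((b l - S l * p l) / (1 + S l * γ l l)) with ha
    set R : ℕ → ℕ → ℝ := fun t s => K t s - ∑ l ∈ Finset.Ico 1 k,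
      γ t l * γ s l * (S l / (1 + S l * γ l l)) with hR
    have hak : a k = p k := (predictor_eq m S γ b k).symm
    have hRk : ∀ t, k ≤ t → t ≤ N → R t k = γ t k := fun t h1 h2 => (hγ t k hk1 h1 h2).symm
    have hRk' : ∀ t, k ≤ t → t ≤ N → R k t = γ t k := fun t h1 h2 => by
      rw [← hRk t h1 h2, hR]
      simp only
      rw [hK k t hk1 (hk1.trans h1)]
      congr 1
      exact Finset.sum_congr rfl fun l _ => by ring
    set C := ∏ r ∈ Finset.Ico 1 k, (√(1 + S r * γ r r))⁻¹ with hC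
    have hCpos : 0 < C := Finset.prod_pos fun r hr => by
      have := hS r (Finset.mem_Ico.1 hr).1 ((Finset.mem_Ico.1 hr).2.le.trans hk')
      positivity
    set q := ∑ r ∈ Finset.Ico 1 k, (-(S r / 2) * p r ^ 2 + b r * p r +
          γ r r / 2 * b r ^ 2) / (1 + S r * γ r r) with hq
    set L := ∑ t ∈ J, v t * γ t k with hL
    set c := q + ∑ t ∈ J, v t * a t + 1 / 2 * ∑ t ∈ J, ∑ s ∈ J, v t * v s * R t s with hc
    set E : Ω → ℝ := fun ω => ∑ r ∈ Finset.Ico 1 k, (-(S r / 2) * X r ω ^ 2 + b r * X r ω) +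
      ∑ t ∈ J, v t * X t ω with hE
    have hEm : Measurable E := by
      refine (Finset.measurable_fun_sum _ fun t ht => ?_).add
        (Finset.measurable_fun_sum _ fun t ht => ?_)
      · have := hX t (Finset.mem_Ico.1 ht).1
        fun_prop
      · have := hX t (by have := hJk t ht; omega)
        fun_prop
    have hXk := hX k hk1
    have hIco : Finset.Ico k (N + 1) = insert k J := (Finset.insert_Ico_succ_left_eq_Ico hkN).symm
    have hkJ : k ∉ J := by simp [hJ]
    -- Under the tilt by `E`, the remaining linear form shifts the mean of `X k` by its covariance
    -- `L` with `X k`. Giving `X k` a free coefficient `s` in the induction hypothesis yields the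
    -- required exponential moments.
    have hmap : (P.withDensity fun ω => ENNReal.ofReal (Real.exp (E ω))).map (X k) =
        ENNReal.ofReal (C * Real.exp c) • gaussianReal (p k + L) (γ k k).toNNReal := by
      refine map_eq_smul_gaussianReal _ hXk _ _ _ (by positivity) (hγ0 k hk1 hk') fun s => ?_
      rw [lintegral_withDensity_eq_lintegral_mul _ (by fun_prop) (by fun_prop)]
      have hu : ∀ t ∈ J, Function.update v k s t = v t := fun t ht =>
        Function.update_of_ne (by have := hJk t ht; omega) _ _
      have hsum : ∀ f : ℕ → ℝ, ∑ t ∈ Finset.Ico k (N + 1), Function.update v k s t * f t =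
          s * f k + ∑ t ∈ J, v t * f t := fun f => by
        rw [hIco, Finset.sum_insert hkJ, Function.update_self]
        congr 1
        exact Finset.sum_congr rfl fun t ht => by rw [hu t ht]
      have := ih (by omega) (Function.update v k s)
      simp only [mul_assoc (Function.update v k s _), ← Finset.mul_sum] at this
      simp only [hsum] at this
      convert this using 1
      · refine lintegral_congr fun ω => ?_
        rw [Pi.mul_apply, ← ENNReal.ofReal_mul (Real.exp_nonneg _), ← Real.exp_add]
        simp only [hE]
        ring_nf
      · have e1 : ∀ t ∈ J, K t k - ∑ l ∈ Finset.Ico 1 k, γ t l * γ k l * (S l / (1 + S l * γ l l))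
            = γ t k := fun t ht => by
          rw [← hRk t (hJk t ht).1.le (hJk t ht).2]
        have e2 : ∀ t ∈ J, K k t - ∑ l ∈ Finset.Ico 1 k, γ k l * γ t l * (S l / (1 + S l * γ l l))
            = γ t k := fun t ht => by
          rw [← hRk' t (hJk t ht).1.le (hJk t ht).2]
        have e3 : K k k - ∑ l ∈ Finset.Ico 1 k, γ k l * γ k l * (S l / (1 + S l * γ l l))
            = γ k k := by
          rw [← hRk k le_rfl hk']
        have e4 : ∑ t ∈ J, v t * (K k t - ∑ l ∈ Finset.Ico 1 k,
            γ k l * γ t l * (S l / (1 + S l * γ l l))) = L :=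
          Finset.sum_congr rfl fun t ht => by rw [e2 t ht]
        have e5 : ∑ t ∈ J, v t * (s * (K t k - ∑ l ∈ Finset.Ico 1 k,
            γ t l * γ k l * (S l / (1 + S l * γ l l))) + ∑ u ∈ J, v u * (K t u -
            ∑ l ∈ Finset.Ico 1 k, γ t l * γ u l * (S l / (1 + S l * γ l l)))) =
            s * L + ∑ t ∈ J, ∑ u ∈ J, v t * v u * R t u := by
          rw [hL, Finset.mul_sum, ← Finset.sum_add_distrib]
          refine Finset.sum_congr rfl fun t ht => ?_
          rw [e1 t ht, mul_add, Finset.mul_sum]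
          simp only [hR, mul_assoc]
          rw [mul_left_comm (v t)]
        rw [e3, e4, e5, mul_assoc, ← Real.exp_add]
        congr 3
        rw [hc, ← hak]
        simp only [ha]
        ring
    have hlhs : ∀ ω, ENNReal.ofReal (Real.exp (
        ∑ r ∈ Finset.Ico 1 (k + 1), (-(S r / 2) * X r ω ^ 2 + b r * X r ω) +
        ∑ t ∈ J, v t * X t ω)) = ENNReal.ofReal (Real.exp (E ω)) *
          ENNReal.ofReal (Real.exp (-(S k / 2) * X k ω ^ 2 + b k * X k ω)) := fun ω => by
      rw [← ENNReal.ofReal_mul (Real.exp_nonneg _), ← Real.exp_add, Finset.sum_Ico_succ_top hk1]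
      simp only [hE]
      ring_nf
    simp_rw [hlhs]
    have h1 := lintegral_withDensity_eq_lintegral_mul P
      (f := fun ω => ENNReal.ofReal (Real.exp (E ω))) (by fun_prop)
      (g := fun ω => ENNReal.ofReal (Real.exp (-(S k / 2) * X k ω ^ 2 + b k * X k ω)))
      (by fun_prop)
    simp only [Pi.mul_apply] at h1
    rw [← h1]
    have h2 := lintegral_map (μ := P.withDensity fun ω => ENNReal.ofReal (Real.exp (E ω)))
      (f := fun x => ENNReal.ofReal (Real.exp (-(S k / 2) * x ^ 2 + b k * x))) (by fun_prop) hXk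
    rw [← h2, hmap, lintegral_smul_measure, lintegral_exp_quadratic_gaussianReal _ _ _ _
      (hγ0 k hk1 hk') hDpos, smul_eq_mul, ← ENNReal.ofReal_mul (by positivity)]
    rw [Finset.prod_Ico_succ_top hk1, Finset.sum_Ico_succ_top hk1]
    -- Integrating out `X k` with mean p_k + L leaves terms linear and quadratic in `L`: the former
    -- update the mean, the latter are the rank-one change of covariance.
    have e6 : ∑ t ∈ J, v t * (m t + ∑ l ∈ Finset.Ico 1 (k + 1),
        γ t l * ((b l - S l * p l) / (1 + S l * γ l l))) =
        ∑ t ∈ J, v t * a t + L * ((b k - S k * p k) / D) := by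
      rw [hL, Finset.sum_mul, ← Finset.sum_add_distrib]
      refine Finset.sum_congr rfl fun t ht => ?_
      rw [Finset.sum_Ico_succ_top hk1]
      simp only [ha]
      ring
    have e7 : ∑ t ∈ J, ∑ s ∈ J, v t * v s * (K t s - ∑ l ∈ Finset.Ico 1 (k + 1),
        γ t l * γ s l * (S l / (1 + S l * γ l l))) =
        ∑ t ∈ J, ∑ s ∈ J, v t * v s * R t s - L * L * (S k / D) := by
      rw [hL, Finset.sum_mul_sum, Finset.sum_mul, ← Finset.sum_sub_distrib]
      refine Finset.sum_congr rfl fun t ht => ?_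
      rw [Finset.sum_mul, ← Finset.sum_sub_distrib]
      refine Finset.sum_congr rfl fun s hs => ?_
      rw [Finset.sum_Ico_succ_top hk1]
      simp only [hR]
      ring
    rw [e6, e7]
    congr 1
    rw [show ∀ x y z w : ℝ, x * y * (z * w) = (x * z) * (y * w) from fun x y z w => by ring,
      ← Real.exp_add]
    congr 2
    rw [hc, ← hD, ← hq]
    have := hDpos.ne'
    clear_value q D
    field_simp
    ring

/-! ### Change of measure: the observations become white noise -/

lemma sum_Ico_one_eq_sum_fin {M : Type*} [AddCommMonoid M] (f : ℕ → M) (n : ℕ) :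
    ∑ t ∈ Finset.Ico 1 (n + 1), f t = ∑ i : Fin n, f (i + 1) := by
  rw [Fin.sum_univ_eq_sum_range (fun i => f (i + 1)), Finset.range_eq_Ico]
  exact (Finset.sum_Ico_add' f 0 n 1).symm

lemma obsField_mono {Ω : Type*} (Y : ℕ → Ω → ℝ) {s t : ℕ} (hst : s ≤ t) :
    obsField Y s ≤ obsField Y t :=
  iSup₂_le fun u hu => le_iSup₂_of_le u ⟨hu.1, hu.2.trans hst⟩ le_rfl

lemma measurable_obsField {Ω : Type*} (Y : ℕ → Ω → ℝ) {u t : ℕ} (hu : 1 ≤ u) (hut : u ≤ t) :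
    Measurable[obsField Y t] (Y u) := by
  have h : MeasurableSpace.comap (Y u) (borel ℝ) ≤ obsField Y t :=
    le_iSup₂_of_le u ⟨hu, hut⟩ le_rfl
  rw [← BorelSpace.measurable_eq] at h
  exact Measurable.of_comap_le h

/-- The measure under which the observations up to time `n` are i.i.d. standard Gaussian and
independent of the signal. -/
noncomputable def refMeasure {Ω : Type*} [MeasurableSpace Ω] (P : Measure Ω) (A : ℕ → ℝ)
    (X ε : ℕ → Ω → ℝ) (n : ℕ) : Measure Ω :=
  P.withDensity fun ω => ENNReal.ofReal
    (Real.exp (∑ t ∈ Finset.Ico 1 (n + 1), (-(A t * X t ω * ε t ω) - (A t * X t ω) ^ 2 / 2)))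

section
variable {Ω : Type*} [MeasurableSpace Ω] {P : Measure Ω}
  {X ε : ℕ → Ω → ℝ} {m : ℕ → ℝ} {K : ℕ → ℕ → ℝ}

lemma measurable_obs (hmodel : IsSignalModel P X ε m K) (A : ℕ → ℝ) (t : ℕ) (ht : 1 ≤ t) :
    Measurable (obs A X ε t) :=
  ((hmodel.measurable_signal t ht).const_mul _).add (hmodel.measurable_noise t ht)

lemma measurable_signal_path (hmodel : IsSignalModel P X ε m K) :
    Measurable fun ω => fun t : ℕ => X (t + 1) ω :=
  measurable_pi_lambda _ fun t => hmodel.measurable_signal _ (by omega)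

lemma measurable_refDensity (hmodel : IsSignalModel P X ε m K) (A : ℕ → ℝ) (n : ℕ) :
    Measurable fun ω => ∑ t ∈ Finset.Ico 1 (n + 1),
      (-(A t * X t ω * ε t ω) - (A t * X t ω) ^ 2 / 2) := by
  refine Finset.measurable_fun_sum _ fun t ht => ?_
  have h1 := hmodel.measurable_signal t (Finset.mem_Ico.1 ht).1
  have h2 := hmodel.measurable_noise t (Finset.mem_Ico.1 ht).1
  fun_prop

lemma map_noise_eq_pi (hmodel : IsSignalModel P X ε m K) (n : ℕ) :
    P.map (fun ω => fun i : Fin n => ε (i + 1) ω) =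
      Measure.pi fun _ : Fin n => gaussianReal 0 1 := by
  have h := hmodel.indep_noise.precomp (g := fun i : Fin n => (i : ℕ)) Fin.val_injective
  rw [h.map_fun_eq_pi_map fun i => (hmodel.measurable_noise _ (by omega)).aemeasurable]
  congr 1
  funext i
  exact (hmodel.law_noise _ (by omega)).map_eq

lemma obsField_le (hmodel : IsSignalModel P X ε m K) (A : ℕ → ℝ) (t : ℕ) :
    obsField (obs A X ε) t ≤ ‹MeasurableSpace Ω› :=
  iSup₂_le fun u hu => by
    rw [← BorelSpace.measurable_eq]
    exact (measurable_obs hmodel A u hu.1).comap_le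

variable [IsProbabilityMeasure P]

/-- Girsanov's theorem: the joint law of the signal and the observations under `refMeasure`. -/
lemma map_refMeasure (hmodel : IsSignalModel P X ε m K) (A : ℕ → ℝ) (n : ℕ) :
    (refMeasure P A X ε n).map
        (fun ω => ((fun t : ℕ => X (t + 1) ω), fun i : Fin n => obs A X ε (i + 1) ω)) =
      (P.map fun ω => fun t : ℕ => X (t + 1) ω).prod
        (Measure.pi fun _ : Fin n => gaussianReal 0 1) := by
  have hU := measurable_signal_path hmodel
  have hV : Measurable fun ω => fun i : Fin n => ε (i + 1) ω :=
    measurable_pi_lambda _ fun t => hmodel.measurable_noise _ (by omega)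
  have hY : Measurable fun ω => fun i : Fin n => obs A X ε (i + 1) ω :=
    measurable_pi_lambda _ fun t => measurable_obs hmodel A _ (by omega)
  have hind : IndepFun (fun ω => fun t : ℕ => X (t + 1) ω)
      (fun ω => fun i : Fin n => ε (i + 1) ω) P :=
    hmodel.indep_signal_noise.comp (φ := id) (ψ := fun (e : ℕ → ℝ) (i : Fin n) => e i)
      measurable_id (by fun_prop)
  have hjoint := (indepFun_iff_map_prod_eq_prod_map_map hU.aemeasurable hV.aemeasurable).1 hind
  rw [map_noise_eq_pi hmodel] at hjoint
  have := Measure.isProbabilityMeasure_map (μ := P) hU.aemeasurable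
  refine Measure.ext_of_lintegral _ fun f hf => ?_
  have hcomp := lintegral_withDensity_eq_lintegral_mul P
    (measurable_refDensity hmodel A n).exp.ennreal_ofReal (hf.comp (hU.prodMk hY))
  simp only [Function.comp_def] at hcomp
  rw [lintegral_map hf (hU.prodMk hY), refMeasure, hcomp]
  -- The weighted integrand in terms of signal and noise, where entry i stands for time i + 1. For a
  -- fixed signal path the observations are a translate of the noise.
  set G : (ℕ → ℝ) × (Fin n → ℝ) → ℝ≥0∞ := fun p =>
    f (p.1, fun i => p.2 i + A (i + 1) * p.1 i) * ENNReal.ofReal (Real.exp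
      (∑ i : Fin n, (-(A (i + 1) * p.1 i * p.2 i) - (A (i + 1) * p.1 i) ^ 2 / 2))) with hG
  have hGm : Measurable G := by
    refine (hf.comp ?_).mul ?_ <;> fun_prop
  have h1 : ∀ ω, (G ((fun t : ℕ => X (t + 1) ω), fun i : Fin n => ε (i + 1) ω)) =
      ((fun ω => ENNReal.ofReal (Real.exp (∑ t ∈ Finset.Ico 1 (n + 1),
        (-(A t * X t ω * ε t ω) - (A t * X t ω) ^ 2 / 2)))) *
      fun ω => f ((fun t : ℕ => X (t + 1) ω), fun i : Fin n => obs A X ε (i + 1) ω)) ω := by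
    intro ω
    simp only [hG, Pi.mul_apply, obs, sum_Ico_one_eq_sum_fin]
    rw [mul_comm]
    simp_rw [add_comm (ε _ _)]
  rw [← lintegral_congr h1, ← lintegral_map hGm (hU.prodMk hV), hjoint, lintegral_prod _
    hGm.aemeasurable, lintegral_prod _ hf.aemeasurable]
  refine lintegral_congr fun x => ?_
  exact lintegral_shift_pi_gaussianReal (fun i : Fin n => A (i + 1) * x i)
    (g := fun y => f (x, y)) (by fun_prop)

lemma isProbabilityMeasure_refMeasure (hmodel : IsSignalModel P X ε m K) (A : ℕ → ℝ) (n : ℕ) :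
    IsProbabilityMeasure (refMeasure P A X ε n) := by
  have hU := measurable_signal_path hmodel
  have hY : Measurable fun ω => fun i : Fin n => obs A X ε (i + 1) ω :=
    measurable_pi_lambda _ fun t => measurable_obs hmodel A _ (by omega)
  have := Measure.isProbabilityMeasure_map (μ := P) hU.aemeasurable
  have h : IsProbabilityMeasure ((refMeasure P A X ε n).map
      (fun ω => ((fun t : ℕ => X (t + 1) ω), fun i : Fin n => obs A X ε (i + 1) ω))) := by
    rw [map_refMeasure hmodel]; infer_instance
  exact Measure.isProbabilityMeasure_of_map (μ := refMeasure P A X ε n)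
    (f := fun ω => ((fun t : ℕ => X (t + 1) ω), fun i : Fin n => obs A X ε (i + 1) ω))

lemma map_signal_refMeasure (hmodel : IsSignalModel P X ε m K) (A : ℕ → ℝ) (n : ℕ) :
    (refMeasure P A X ε n).map (fun ω => fun t : ℕ => X (t + 1) ω) =
      P.map (fun ω => fun t : ℕ => X (t + 1) ω) := by
  have hU := measurable_signal_path hmodel
  have hY : Measurable fun ω => fun i : Fin n => obs A X ε (i + 1) ω :=
    measurable_pi_lambda _ fun t => measurable_obs hmodel A _ (by omega)
  have := congrArg (fun μ => μ.map Prod.fst) (map_refMeasure hmodel A n)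
  simpa [Measure.map_map measurable_fst (hU.prodMk hY), Function.comp_def] using this

lemma map_obs_refMeasure (hmodel : IsSignalModel P X ε m K) (A : ℕ → ℝ) (n : ℕ) :
    (refMeasure P A X ε n).map (fun ω => fun i : Fin n => obs A X ε (i + 1) ω) =
      Measure.pi fun _ : Fin n => gaussianReal 0 1 := by
  have hU := measurable_signal_path hmodel
  have hY : Measurable fun ω => fun i : Fin n => obs A X ε (i + 1) ω :=
    measurable_pi_lambda _ fun t => measurable_obs hmodel A _ (by omega)
  have := Measure.isProbabilityMeasure_map (μ := P) hU.aemeasurable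
  have := congrArg (fun μ => μ.map Prod.snd) (map_refMeasure hmodel A n)
  simpa [Measure.map_map measurable_snd (hU.prodMk hY), Function.comp_def] using this

lemma indep_obsField_signal (hmodel : IsSignalModel P X ε m K) (A : ℕ → ℝ) (n : ℕ) :
    Indep (obsField (obs A X ε) n)
      (MeasurableSpace.comap (fun ω => fun t : ℕ => X (t + 1) ω) inferInstance)
      (refMeasure P A X ε n) := by
  have hU := measurable_signal_path hmodel
  have hY : Measurable fun ω => fun i : Fin n => obs A X ε (i + 1) ω :=
    measurable_pi_lambda _ fun t => measurable_obs hmodel A _ (by omega)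
  have := isProbabilityMeasure_refMeasure hmodel A n
  have h : IndepFun (fun ω => fun t : ℕ => X (t + 1) ω)
      (fun ω => fun i : Fin n => obs A X ε (i + 1) ω) (refMeasure P A X ε n) := by
    rw [indepFun_iff_map_prod_eq_prod_map_map hU.aemeasurable hY.aemeasurable,
      map_signal_refMeasure hmodel, map_obs_refMeasure hmodel, map_refMeasure hmodel]
  refine indep_of_indep_of_le_left ((IndepFun_iff_Indep _ _ _).1 h).symm (iSup₂_le fun u hu => ?_)
  rw [← BorelSpace.measurable_eq, ← measurable_iff_comap_le]
  obtain ⟨i, hi⟩ : ∃ i : Fin n, (i : ℕ) + 1 = u :=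
    ⟨⟨u - 1, by have := hu.1; have := hu.2; omega⟩, by
    have := hu.1; simp; omega⟩
  rw [← hi]
  exact (measurable_pi_apply (X := fun _ : Fin n => ℝ) i).comp (comap_measurable _)

lemma map_obs_apply_refMeasure (hmodel : IsSignalModel P X ε m K) (A : ℕ → ℝ) {n k : ℕ}
    (hk : k < n) : (refMeasure P A X ε n).map (obs A X ε (k + 1)) = gaussianReal 0 1 := by
  have hY : Measurable fun ω => fun i : Fin n => obs A X ε (i + 1) ω :=
    measurable_pi_lambda _ fun t => measurable_obs hmodel A _ (by omega)
  have := congrArg (fun μ => μ.map (Function.eval (⟨k, hk⟩ : Fin n))) (map_obs_refMeasure hmodel A n)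
  simp only [Measure.map_map (measurable_pi_apply _) hY,
    (measurePreserving_eval (fun _ : Fin n => gaussianReal 0 1) ⟨k, hk⟩).map_eq] at this
  exact this

lemma indep_obsField_obs (hmodel : IsSignalModel P X ε m K) (A : ℕ → ℝ) {n k : ℕ} (hk : k < n) :
    Indep (obsField (obs A X ε) k)
      (MeasurableSpace.comap (obs A X ε (k + 1)) inferInstance) (refMeasure P A X ε n) := by
  have hmeas := fun i : Fin n => measurable_obs hmodel A (i + 1) (by omega)
  have := isProbabilityMeasure_refMeasure hmodel A n
  have h : iIndepFun (fun i : Fin n => obs A X ε (i + 1)) (refMeasure P A X ε n) := by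
    rw [iIndepFun_iff_map_fun_eq_pi_map fun i => (hmeas i).aemeasurable,
      map_obs_refMeasure hmodel]
    congr 1
    funext i
    exact (map_obs_apply_refMeasure hmodel A i.2).symm
  -- Indices below k are the times 1, …, k, and index k is the time k + 1.
  have h2 := indep_iSup_of_disjoint (fun i => (hmeas i).comap_le) h
    (S := {i | (i : ℕ) < k}) (T := {⟨k, hk⟩}) (by simp)
  refine indep_of_indep_of_le_left (indep_of_indep_of_le_right h2 ?_) (iSup₂_le fun u hu => ?_)
  · exact le_iSup₂_of_le (⟨k, hk⟩ : Fin n) rfl le_rfl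
  · have h1 := hu.1
    have h2 := hu.2
    refine le_iSup₂_of_le (⟨u - 1, by omega⟩ : Fin n) (show u - 1 < k by omega) ?_
    rw [← BorelSpace.measurable_eq]
    simp only [Nat.sub_add_cancel h1]
    exact le_rfl

end

/-! ### Freezing independent variables -/

/-- Independence lets one integrate out an independent variable. -/
lemma lintegral_comp_of_indepFun {Ω α β : Type*} [MeasurableSpace Ω] [MeasurableSpace α]
    [MeasurableSpace β] {ρ : Measure Ω} [IsProbabilityMeasure ρ] {V : Ω → α} {U : Ω → β}
    (hV : Measurable V) (hU : Measurable U) (h : IndepFun V U ρ) {G : α × β → ℝ≥0∞}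
    (hG : Measurable G) :
    ∫⁻ ω, G (V ω, U ω) ∂ρ = ∫⁻ ω, ∫⁻ x, G (V ω, x) ∂(ρ.map U) ∂ρ := by
  have := Measure.isProbabilityMeasure_map (μ := ρ) hU.aemeasurable
  rw [← lintegral_map hG (hV.prodMk hU),
    (indepFun_iff_map_prod_eq_prod_map_map hV.aemeasurable hU.aemeasurable).1 h,
    lintegral_prod _ hG.aemeasurable, lintegral_map hG.lintegral_prod_right' hV]

/-- The identity, viewed as a map into Ω with the smaller σ-field, serves as the frozen variable;
`G` may thus involve any number of observable quantities. -/
lemma lintegral_comp_of_indep {Ω β : Type*} {m : MeasurableSpace Ω} [mΩ : MeasurableSpace Ω]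
    [mβ : MeasurableSpace β] (hm : m ≤ mΩ) {ρ : Measure[mΩ] Ω} [IsProbabilityMeasure ρ] {U : Ω → β}
    (hU : Measurable U) (h : Indep m (MeasurableSpace.comap U mβ) ρ) {G : Ω × β → ℝ≥0∞}
    (hG : Measurable[m.prod mβ] G) :
    ∫⁻ ω, G (ω, U ω) ∂ρ = ∫⁻ ω, ∫⁻ x, G (ω, x) ∂(ρ.map U) ∂ρ := by
  refine @lintegral_comp_of_indepFun Ω Ω β mΩ m mβ ρ _ id U (measurable_id'' hm) hU ?_ G hG
  have h' : Indep (MeasurableSpace.comap id m) (MeasurableSpace.comap U mβ) ρ := by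
    rwa [MeasurableSpace.comap_id]
  exact h'

lemma predictor_congr {m S : ℕ → ℝ} {γ : ℕ → ℕ → ℝ} {b b' : ℕ → ℝ} {t : ℕ}
    (h : ∀ l, 1 ≤ l → l < t → b l = b' l) : predictor m S γ b t = predictor m S γ b' t := by
  induction t using Nat.strong_induction_on with
  | _ t ih =>
    rw [predictor_eq, predictor_eq]
    congr 1
    refine Finset.sum_congr rfl fun l hl => ?_
    obtain ⟨h1, h2⟩ := Finset.mem_Ico.1 hl
    rw [h l h1 h2, ih l h2 fun r hr1 hr2 => h r hr1 (hr2.trans h2)]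

lemma measurable_predictor {Ω : Type*} [MeasurableSpace Ω] {m S : ℕ → ℝ} {γ : ℕ → ℕ → ℝ}
    {b : ℕ → Ω → ℝ} {t : ℕ} (hb : ∀ l, 1 ≤ l → l < t → Measurable (b l)) :
    Measurable fun ω => predictor m S γ (fun l => b l ω) t := by
  induction t using Nat.strong_induction_on with
  | _ t ih =>
    simp_rw [predictor_eq m S γ _ t]
    refine measurable_const.add (Finset.measurable_fun_sum _ fun l hl => ?_)
    obtain ⟨h1, h2⟩ := Finset.mem_Ico.1 hl
    have h3 := ih l h2 fun r hr1 hr2 => hb r hr1 (hr2.trans h2)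
    have h4 := hb l h1 h2
    fun_prop

/-! ### Optimal estimates and completion of the square -/

/-- The linear coefficients of the tilting of the signal which is induced by the observations `Y`
and by the estimates `h`. -/
def tiltCoeff {Ω : Type*} (A Q : ℕ → ℝ) (μ : ℝ) (Y h : ℕ → Ω → ℝ) (ω : Ω) (l : ℕ) : ℝ :=
  A l * Y l ω - μ * Q l * h l ω

/-- The mean of `X_t` given `Y_1, …, Y_{t-1}` under the tilting induced by the estimates `h`. -/
noncomputable def riskMean {Ω : Type*} (m : ℕ → ℝ) (γ : ℕ → ℕ → ℝ) (A Q : ℕ → ℝ) (μ : ℝ)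
    (Y h : ℕ → Ω → ℝ) (t : ℕ) (ω : Ω) : ℝ :=
  predictor m (weight A Q μ) γ (tiltCoeff A Q μ Y h ω) t

/-- The optimal estimate of `X_t` given the estimates `h_1, …, h_{t-1}`. -/
noncomputable def riskEstimate {Ω : Type*} (m : ℕ → ℝ) (γ : ℕ → ℕ → ℝ) (A Q : ℕ → ℝ) (μ : ℝ)
    (Y h : ℕ → Ω → ℝ) (t : ℕ) (ω : Ω) : ℝ :=
  (riskMean m γ A Q μ Y h t ω + γ t t * A t * Y t ω) / (1 + A t ^ 2 * γ t t)

/-- The log-likelihood ratio of `𝒩(A a, 1 + A² γ)` with respect to `𝒩(0, 1)`, up to a constant. -/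
noncomputable def logLik (A γ a y : ℝ) : ℝ :=
  (-(A * a) ^ 2 + 2 * (A * a) * y + γ * A ^ 2 * y ^ 2) / (2 * (1 + A ^ 2 * γ))

@[fun_prop]
lemma measurable_logLik {Ω : Type*} [MeasurableSpace Ω] (A γ : ℝ) {a y : Ω → ℝ}
    (ha : Measurable a) (hy : Measurable y) : Measurable fun ω => logLik A γ (a ω) (y ω) := by
  unfold logLik; fun_prop

/-- After division by √(1 + A² γ) the integrand is a probability density with respect to the
standard Gaussian. The mass does not depend on `a`, which is why the optimal value will not depend
on the estimates. -/
lemma lintegral_exp_logLik (A γ a : ℝ) (hγ : 0 ≤ γ) :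
    ∫⁻ y, ENNReal.ofReal (Real.exp (logLik A γ a y)) ∂(gaussianReal 0 1) =
      ENNReal.ofReal √(1 + A ^ 2 * γ) := by
  have hE : 0 < 1 + A ^ 2 * γ := by positivity
  have h1 : 1 + -(A ^ 2 * γ) / (1 + A ^ 2 * γ) * 1 = (1 + A ^ 2 * γ)⁻¹ := by field_simp; ring
  have h := lintegral_exp_quadratic_gaussianReal 0 (-(A ^ 2 * γ) / (1 + A ^ 2 * γ))
    (A * a / (1 + A ^ 2 * γ)) 1 zero_le_one (by rw [h1]; positivity)
  rw [h1, Real.toNNReal_one] at h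
  have h2 : ∀ y, ENNReal.ofReal (Real.exp (logLik A γ a y)) =
      ENNReal.ofReal (Real.exp (-(A * a) ^ 2 / (2 * (1 + A ^ 2 * γ)))) *
      ENNReal.ofReal (Real.exp (-(-(A ^ 2 * γ) / (1 + A ^ 2 * γ) / 2) * y ^ 2 +
        A * a / (1 + A ^ 2 * γ) * y)) := fun y => by
    rw [← ENNReal.ofReal_mul (Real.exp_nonneg _), ← Real.exp_add, logLik]
    congr 2
    field_simp
    ring
  simp_rw [h2]
  rw [lintegral_const_mul _ (by fun_prop), h, ← ENNReal.ofReal_mul (Real.exp_nonneg _),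
    Real.sqrt_inv, inv_inv, mul_left_comm, ← Real.exp_add]
  congr 1
  rw [show -(A * a) ^ 2 / (2 * (1 + A ^ 2 * γ)) + (-(-(A ^ 2 * γ) / (1 + A ^ 2 * γ) / 2) * 0 ^ 2 +
    A * a / (1 + A ^ 2 * γ) * 0 + 1 / 2 * (A * a / (1 + A ^ 2 * γ)) ^ 2) / (1 + A ^ 2 * γ)⁻¹ = 0 by
    field_simp; ring]
  simp

/-- Completion of the square in the estimate `h`. -/
lemma tilt_exponent_eq {A μ Q γ a y h : ℝ} (hD : 1 + (A ^ 2 - μ * Q) * γ ≠ 0)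
    (hE : 1 + A ^ 2 * γ ≠ 0) :
    (-((A ^ 2 - μ * Q) / 2) * a ^ 2 + (A * y - μ * Q * h) * a +
        γ / 2 * (A * y - μ * Q * h) ^ 2) / (1 + (A ^ 2 - μ * Q) * γ) + μ / 2 * (h ^ 2 * Q) =
      logLik A γ a y + μ * Q * (1 + A ^ 2 * γ) / (2 * (1 + (A ^ 2 - μ * Q) * γ)) *
        (h - (a + γ * A * y) / (1 + A ^ 2 * γ)) ^ 2 := by
  rw [logLik]
  generalize hDD : 1 + (A ^ 2 - μ * Q) * γ = D at *
  generalize hEE : 1 + A ^ 2 * γ = E at *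
  rw [← sub_eq_zero]
  field_simp
  subst hDD hEE
  ring

/-- At the optimal estimate the predictor's correction no longer involves μ Q explicitly and becomes
the innovation term of the filter. -/
lemma update_coeff_eq {A μ Q γ a y h : ℝ} (hD : 1 + (A ^ 2 - μ * Q) * γ ≠ 0)
    (hE : 1 + A ^ 2 * γ ≠ 0) (hh : h = (a + γ * A * y) / (1 + A ^ 2 * γ)) :
    (A * y - μ * Q * h - (A ^ 2 - μ * Q) * a) / (1 + (A ^ 2 - μ * Q) * γ) =
      A * (y - A * h) := by
  rw [div_eq_iff hD]
  have h1 : h * (1 + A ^ 2 * γ) = a + γ * A * y := by rw [hh, div_mul_cancel₀ _ hE]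
  linear_combination (A ^ 2 - μ * Q) * h1

lemma Icc_one_eq_Ico (n : ℕ) : Finset.Icc 1 n = Finset.Ico 1 (n + 1) := by
  ext; simp

/-- The filtering recursion produces the optimal estimates. -/
lemma IsFilterSolution.eq_riskEstimate {Ω : Type*} {m A Q : ℕ → ℝ} {μ : ℝ} {γ : ℕ → ℕ → ℝ}
    {Y h : ℕ → Ω → ℝ} {T : ℕ} (hh : IsFilterSolution m A γ Y T h)
    (hγ0 : ∀ l, 1 ≤ l → l ≤ T → 0 ≤ γ l l)
    (hS : ∀ l, 1 ≤ l → l ≤ T → 0 < 1 + weight A Q μ l * γ l l) (ω : Ω) :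
    ∀ t, 1 ≤ t → t ≤ T → h t ω = riskEstimate m γ A Q μ Y h t ω := by
  intro t
  induction t using Nat.strong_induction_on with
  | _ t ih =>
    intro h1 hT
    have hE : 0 < 1 + A t ^ 2 * γ t t := by have := hγ0 t h1 hT; positivity
    have hmean : riskMean m γ A Q μ Y h t ω =
        m t + ∑ l ∈ Finset.Ico 1 t, A l * γ t l * (Y l ω - A l * h l ω) := by
      rw [riskMean, predictor_eq]
      congr 1
      refine Finset.sum_congr rfl fun l hl => ?_
      obtain ⟨hl1, hlt⟩ := Finset.mem_Ico.1 hl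
      have hlT := hlt.le.trans hT
      have := update_coeff_eq (hS l hl1 hlT).ne'
        (by have := hγ0 l hl1 hlT; positivity) (ih l hlt hl1 hlT)
      simp only [riskMean] at this
      simp only [tiltCoeff, weight] at this ⊢
      rw [this]
      ring
    have := hh t h1 hT ω
    rw [Icc_one_eq_Ico, Finset.sum_Ico_succ_top h1] at this
    rw [riskEstimate, hmean, eq_div_iff hE.ne']
    linear_combination this

/-- Predictability: the tilted mean at time k + 1 uses only estimates and observations up to k. -/
lemma measurable_riskMean {Ω : Type*} {m : ℕ → ℝ} {γ : ℕ → ℕ → ℝ} {A Q : ℕ → ℝ} {μ : ℝ} {n : ℕ}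
    {Y h : ℕ → Ω → ℝ} (hh : IsObsAdapted Y n h) {k : ℕ} (hk : k ≤ n) :
    Measurable[obsField Y k] (riskMean m γ A Q μ Y h (k + 1)) := by
  refine @measurable_predictor Ω (obsField Y k) m _ γ (fun l ω => tiltCoeff A Q μ Y h ω l) _ ?_
  intro l h1 h2
  have hl : l ≤ k := by omega
  exact ((measurable_obsField Y h1 hl).const_mul _).sub
    (((hh l h1 (hl.trans hk)).mono (obsField_mono Y hl) le_rfl).const_mul _)

/-! ### The exponential criterion under the reference measure -/

section
variable {Ω : Type*} [MeasurableSpace Ω] {P : Measure Ω} [IsProbabilityMeasure P]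
  {X ε : ℕ → Ω → ℝ} {m : ℕ → ℝ} {K γ : ℕ → ℕ → ℝ} {A Q : ℕ → ℝ} {μ : ℝ} {n : ℕ}
  {h : ℕ → Ω → ℝ}

/-- The last observation is integrated out first: its mean parameter is frozen by the past, so it
contributes a constant factor, whatever the predictable `p`. -/
lemma lintegral_exp_sum_logLik (hmodel : IsSignalModel P X ε m K)
    (hγ0 : ∀ l, 1 ≤ l → l ≤ n → 0 ≤ γ l l) {p : ℕ → Ω → ℝ}
    (hp : ∀ k, k < n → Measurable[obsField (obs A X ε) k] (p (k + 1))) {k : ℕ} (hk : k ≤ n) :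
    ∫⁻ ω, ENNReal.ofReal (Real.exp (∑ t ∈ Finset.Ico 1 (k + 1),
        logLik (A t) (γ t t) (p t ω) (obs A X ε t ω))) ∂(refMeasure P A X ε n) =
      ENNReal.ofReal (∏ t ∈ Finset.Ico 1 (k + 1), √(1 + A t ^ 2 * γ t t)) := by
  have := isProbabilityMeasure_refMeasure hmodel A n
  induction k with
  | zero => simp
  | succ k ih =>
    have hkn : k < n := hk
    set F : Ω → ℝ := fun ω => ∑ t ∈ Finset.Ico 1 (k + 1),
        logLik (A t) (γ t t) (p t ω) (obs A X ε t ω) with hF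
    have hFm : Measurable[obsField (obs A X ε) k] F := by
      refine Finset.measurable_fun_sum _ fun t ht => ?_
      obtain ⟨u, rfl⟩ := Nat.exists_eq_add_of_le' (Finset.mem_Ico.1 ht).1
      have hu : u < k := by have := (Finset.mem_Ico.1 ht).2; omega
      exact @measurable_logLik Ω (obsField (obs A X ε) k) _ _ _ _
        ((hp u (by omega)).mono (obsField_mono _ hu.le) le_rfl)
        (measurable_obsField _ (by omega) hu)
    have hG : ∀ {mm : MeasurableSpace Ω}, Measurable F → Measurable (p (k + 1)) →
        Measurable fun q : Ω × ℝ => ENNReal.ofReal (Real.exp (F q.1)) * ENNReal.ofReal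
          (Real.exp (logLik (A (k + 1)) (γ (k + 1) (k + 1)) (p (k + 1) q.1) q.2)) := by
      intro mm h1 h2
      have h3 : Measurable fun q : Ω × ℝ => F q.1 := h1.comp measurable_fst
      have h4 : Measurable fun q : Ω × ℝ => p (k + 1) q.1 := h2.comp measurable_fst
      exact (h3.exp.ennreal_ofReal).mul
        ((measurable_logLik _ _ h4 measurable_snd).exp.ennreal_ofReal)
    have hsplit : ∀ ω, ENNReal.ofReal (Real.exp (∑ t ∈ Finset.Ico 1 (k + 1 + 1),
        logLik (A t) (γ t t) (p t ω) (obs A X ε t ω))) = ENNReal.ofReal (Real.exp (F ω)) *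
        ENNReal.ofReal (Real.exp (logLik (A (k + 1)) (γ (k + 1) (k + 1)) (p (k + 1) ω)
          (obs A X ε (k + 1) ω))) := fun ω => by
      rw [Finset.sum_Ico_succ_top (by omega), Real.exp_add, ENNReal.ofReal_mul (Real.exp_nonneg _)]
    simp_rw [hsplit]
    rw [lintegral_comp_of_indep (obsField_le hmodel A k) (measurable_obs hmodel A _ (by omega))
      (indep_obsField_obs hmodel A hkn) (hG hFm (hp k hkn)), map_obs_apply_refMeasure hmodel A hkn]
    have hin : ∀ ω, ∫⁻ x, ENNReal.ofReal (Real.exp (F ω)) * ENNReal.ofReal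
        (Real.exp (logLik (A (k + 1)) (γ (k + 1) (k + 1)) (p (k + 1) ω) x)) ∂(gaussianReal 0 1) =
        ENNReal.ofReal (Real.exp (F ω)) *
          ENNReal.ofReal √(1 + A (k + 1) ^ 2 * γ (k + 1) (k + 1)) := fun ω => by
      rw [lintegral_const_mul _ (by fun_prop), lintegral_exp_logLik _ _ _ (hγ0 _ (by omega) hk)]
    simp only [hin]
    have hFm' : Measurable F := hFm.mono (obsField_le hmodel A k) le_rfl
    rw [lintegral_mul_const _ (by fun_prop), ih (by omega),
      Finset.prod_Ico_succ_top (show 1 ≤ k + 1 by omega),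
      ← ENNReal.ofReal_mul (Finset.prod_nonneg fun _ _ => Real.sqrt_nonneg _)]

/-- The normalising constant in the optimal value of the exponential criterion. -/
noncomputable def tiltConst (γ : ℕ → ℕ → ℝ) (S : ℕ → ℝ) (n : ℕ) : ℝ :=
  ∏ r ∈ Finset.Ico 1 (n + 1), (√(1 + S r * γ r r))⁻¹

/-- The loss caused by using the estimates `h` in place of the optimal ones. -/
noncomputable def riskLoss (m : ℕ → ℝ) (γ : ℕ → ℕ → ℝ) (A Q : ℕ → ℝ) (μ : ℝ)
    (Y h : ℕ → Ω → ℝ) (n : ℕ) (ω : Ω) : ℝ :=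
  ∑ t ∈ Finset.Ico 1 (n + 1), μ * Q t * (1 + A t ^ 2 * γ t t) /
    (2 * (1 + weight A Q μ t * γ t t)) * (h t ω - riskEstimate m γ A Q μ Y h t ω) ^ 2

/-- The exponential criterion, as an expectation under `refMeasure`. -/
lemma lintegral_exp_risk (hmodel : IsSignalModel P X ε m K)
    (hγ : IsGammaSolution K A Q μ n γ) (hγ0 : ∀ l, 1 ≤ l → l ≤ n → 0 ≤ γ l l)
    (hS : ∀ l, 1 ≤ l → l ≤ n → 0 < 1 + weight A Q μ l * γ l l)
    (hh : IsObsAdapted (obs A X ε) n h) :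
    ∫⁻ ω, ENNReal.ofReal (Real.exp (μ / 2 * ∑ t ∈ Finset.Icc 1 n,
        (X t ω - h t ω) ^ 2 * Q t)) ∂P =
      ∫⁻ ω, ENNReal.ofReal (tiltConst γ (weight A Q μ) n *
        Real.exp (∑ t ∈ Finset.Ico 1 (n + 1), logLik (A t) (γ t t)
          (riskMean m γ A Q μ (obs A X ε) h t ω) (obs A X ε t ω))) *
        ENNReal.ofReal (Real.exp (riskLoss m γ A Q μ (obs A X ε) h n ω))
        ∂(refMeasure P A X ε n) := by
  have := isProbabilityMeasure_refMeasure hmodel A n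
  set Y := obs A X ε with hY
  set I := Finset.Ico 1 (n + 1) with hI
  have hI1 : ∀ t ∈ I, 1 ≤ t := fun t ht => (Finset.mem_Ico.1 ht).1
  have hI2 : ∀ t ∈ I, t ≤ n := fun t ht => by have := (Finset.mem_Ico.1 ht).2; omega
  set H : Ω → ℝ := fun ω => ∑ t ∈ I, μ / 2 * (h t ω ^ 2 * Q t) with hH
  -- The first argument enters only through observable quantities; coordinate t - 1 of the path is
  -- the signal at time t.
  set G : Ω × (ℕ → ℝ) → ℝ≥0∞ := fun q => ENNReal.ofReal (Real.exp (H q.1)) *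
    ENNReal.ofReal (Real.exp (∑ t ∈ I, (-(weight A Q μ t / 2) * q.2 (t - 1) ^ 2 +
      tiltCoeff A Q μ Y h q.1 t * q.2 (t - 1)))) with hG
  have hbm : ∀ t ∈ I, Measurable[obsField Y n] fun ω => tiltCoeff A Q μ Y h ω t := fun t ht =>
    ((measurable_obsField Y (hI1 t ht) (hI2 t ht)).const_mul _).sub
      (((hh t (hI1 t ht) (hI2 t ht)).mono (obsField_mono Y (hI2 t ht)) le_rfl).const_mul _)
  have hhm : ∀ t ∈ I, Measurable[obsField Y n] (h t) := fun t ht =>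
    (hh t (hI1 t ht) (hI2 t ht)).mono (obsField_mono Y (hI2 t ht)) le_rfl
  have hGgen : ∀ {mm : MeasurableSpace Ω}, (∀ t ∈ I, Measurable fun ω => tiltCoeff A Q μ Y h ω t) →
      (∀ t ∈ I, Measurable (h t)) → Measurable G := by
    intro mm h1 h2
    have h3 : ∀ t ∈ I, Measurable fun q : Ω × (ℕ → ℝ) => h t q.1 :=
      fun t ht => (h2 t ht).comp measurable_fst
    have h4 : ∀ t ∈ I, Measurable fun q : Ω × (ℕ → ℝ) => tiltCoeff A Q μ Y h q.1 t :=
      fun t ht => (h1 t ht).comp measurable_fst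
    have h5 : ∀ t, Measurable fun q : Ω × (ℕ → ℝ) => q.2 (t - 1) := fun t =>
      (measurable_pi_apply (t - 1)).comp measurable_snd
    have h6 : Measurable fun q : Ω × (ℕ → ℝ) => H q.1 := Finset.measurable_fun_sum _ fun t ht =>
      (((h3 t ht).pow_const 2).mul_const _).const_mul _
    have h7 : Measurable fun q : Ω × (ℕ → ℝ) => ∑ t ∈ I, (-(weight A Q μ t / 2) * q.2 (t - 1) ^ 2 +
        tiltCoeff A Q μ Y h q.1 t * q.2 (t - 1)) := Finset.measurable_fun_sum _ fun t ht =>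
      (((h5 t).pow_const 2).const_mul _).add ((h4 t ht).mul (h5 t))
    exact h6.exp.ennreal_ofReal.mul h7.exp.ennreal_ofReal
  have hGm : Measurable[(obsField Y n).prod MeasurableSpace.pi] G := hGgen hbm hhm
  have hle := obsField_le hmodel A n
  have hGm' : Measurable G := hGgen (fun t ht => (hbm t ht).mono hle le_rfl)
    fun t ht => (hhm t ht).mono hle le_rfl
  have hU := measurable_signal_path hmodel
  have hdm := measurable_refDensity hmodel A n
  have hshift : ∀ ω, ∀ t ∈ I, X (t - 1 + 1) ω = X t ω := fun ω t ht => by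
    rw [Nat.sub_add_cancel (hI1 t ht)]
  -- Substituting Y = A X + ε, the reference density cancels the likelihood terms in `G`.
  have hchange : ∫⁻ ω, ENNReal.ofReal (Real.exp (μ / 2 * ∑ t ∈ Finset.Icc 1 n,
        (X t ω - h t ω) ^ 2 * Q t)) ∂P =
      ∫⁻ ω, G (ω, fun t => X (t + 1) ω) ∂(refMeasure P A X ε n) := by
    have hcomp := lintegral_withDensity_eq_lintegral_mul P hdm.exp.ennreal_ofReal
      (hGm'.comp (measurable_id.prodMk hU))
    simp only [Function.comp_def, id] at hcomp
    rw [refMeasure, hcomp]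
    refine lintegral_congr fun ω => ?_
    simp only [Pi.mul_apply, hG]
    rw [← ENNReal.ofReal_mul (Real.exp_nonneg _), ← ENNReal.ofReal_mul (Real.exp_nonneg _),
      ← Real.exp_add, ← Real.exp_add, hH, Icc_one_eq_Ico, Finset.mul_sum, ← hI,
      ← Finset.sum_add_distrib, ← Finset.sum_add_distrib]
    congr 2
    refine Finset.sum_congr rfl fun t ht => ?_
    rw [hshift ω t ht]
    simp only [tiltCoeff, weight, hY, obs]
    ring
  rw [hchange, lintegral_comp_of_indep hle hU (indep_obsField_signal hmodel A n) hGm,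
    map_signal_refMeasure hmodel A n]
  refine lintegral_congr fun ω => ?_
  have hGω : Measurable fun x => G (ω, x) := hGm'.comp (by fun_prop)
  rw [lintegral_map hGω hU]
  simp only [hG]
  have hXm : Measurable fun ω' => ∑ t ∈ I, (-(weight A Q μ t / 2) * X (t - 1 + 1) ω' ^ 2 +
      tiltCoeff A Q μ Y h ω t * X (t - 1 + 1) ω') := by
    refine Finset.measurable_fun_sum _ fun t ht => ?_
    have := hmodel.measurable_signal (t - 1 + 1) (by omega)
    fun_prop
  rw [lintegral_const_mul _ hXm.exp.ennreal_ofReal]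
  -- All coordinates are tilted (k = n + 1), so no linear form remains.
  have htilt := lintegral_exp_quadratic_of_lintegral_exp_linear (N := n) (γ := γ)
    (S := weight A Q μ)
    hmodel.measurable_signal (lintegral_exp_linear_of_isSignalModel hmodel n)
    (fun t s ht hs => by
      rw [← hmodel.cov_signal t s ht hs, ← hmodel.cov_signal s t hs ht, covariance_comm])
    hγ.2 hγ0 hS (tiltCoeff A Q μ Y h ω) (k := n + 1) (by omega) le_rfl 0
  simp only [Finset.Ico_self, Finset.sum_empty, add_zero, mul_zero] at htilt
  have hsum : ∀ ω', ∑ t ∈ I, (-(weight A Q μ t / 2) * X (t - 1 + 1) ω' ^ 2 +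
      tiltCoeff A Q μ Y h ω t * X (t - 1 + 1) ω') = ∑ t ∈ I, (-(weight A Q μ t / 2) * X t ω' ^ 2 +
      tiltCoeff A Q μ Y h ω t * X t ω') := fun ω' =>
    Finset.sum_congr rfl fun t ht => by rw [hshift ω' t ht]
  simp_rw [hsum]
  have hC : 0 ≤ tiltConst γ (weight A Q μ) n := Finset.prod_nonneg fun _ _ => by positivity
  rw [htilt, ← tiltConst, ← ENNReal.ofReal_mul (Real.exp_nonneg _),
    ← ENNReal.ofReal_mul (by positivity), mul_left_comm, ← Real.exp_add, mul_assoc, ← Real.exp_add]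
  congr 3
  rw [hH, riskLoss, ← hI, ← Finset.sum_add_distrib, ← Finset.sum_add_distrib]
  refine Finset.sum_congr rfl fun t ht => ?_
  have h1 := hI1 t ht
  have h2 := hI2 t ht
  have := tilt_exponent_eq (y := Y t ω) (h := h t ω) (a := riskMean m γ A Q μ Y h t ω)
    (hS t h1 h2).ne' (by have := hγ0 t h1 h2; positivity : 1 + A t ^ 2 * γ t t ≠ 0)
  rw [riskEstimate, add_comm]
  exact this

end

/-! ### Vanishing of the loss and solvability of the filtering recursion -/

/-- The expectation of the exponential of the accumulated quadratic cost. -/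
noncomputable def expRisk {Ω : Type*} [MeasurableSpace Ω] (P : Measure Ω) (X : ℕ → Ω → ℝ)
    (Q : ℕ → ℝ) (μ : ℝ) (n : ℕ) (h : ℕ → Ω → ℝ) : ℝ≥0∞ :=
  ∫⁻ ω, ENNReal.ofReal (Real.exp (μ / 2 * ∑ t ∈ Finset.Icc 1 n, (X t ω - h t ω) ^ 2 * Q t)) ∂P

/-- The optimal value of `expRisk`. -/
noncomputable def optimalRisk (γ : ℕ → ℕ → ℝ) (A Q : ℕ → ℝ) (μ : ℝ) (n : ℕ) : ℝ≥0∞ :=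
  ENNReal.ofReal (tiltConst γ (weight A Q μ) n) *
    ENNReal.ofReal (∏ t ∈ Finset.Ico 1 (n + 1), √(1 + A t ^ 2 * γ t t))

lemma optimalRisk_ne_top (γ : ℕ → ℕ → ℝ) (A Q : ℕ → ℝ) (μ : ℝ) (n : ℕ) :
    optimalRisk γ A Q μ n ≠ ∞ :=
  ENNReal.mul_ne_top ENNReal.ofReal_ne_top ENNReal.ofReal_ne_top

lemma IsGammaSolution.mono {K : ℕ → ℕ → ℝ} {A Q : ℕ → ℝ} {μ : ℝ} {T n : ℕ} {γ : ℕ → ℕ → ℝ}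
    (hγ : IsGammaSolution K A Q μ T γ) (hn : n ≤ T) : IsGammaSolution K A Q μ n γ :=
  ⟨fun l h1 h2 => hγ.1 l h1 (h2.trans_le hn), fun t s h1 h2 h3 => hγ.2 t s h1 h2 (h3.trans hn)⟩

lemma IsFilterSolution.mono {Ω : Type*} {m A : ℕ → ℝ} {γ : ℕ → ℕ → ℝ} {Y h : ℕ → Ω → ℝ} {T n : ℕ}
    (hh : IsFilterSolution m A γ Y T h) (hn : n ≤ T) : IsFilterSolution m A γ Y n h :=
  fun t h1 h2 => hh t h1 (h2.trans hn)

/-- An estimate enters the tilt only with weight μ Q_l, so degenerate times have no influence. -/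
lemma riskMean_congr {Ω : Type*} {m : ℕ → ℝ} {γ : ℕ → ℕ → ℝ} {A Q : ℕ → ℝ} {μ : ℝ}
    {Y h h' : ℕ → Ω → ℝ} {t : ℕ} {ω : Ω}
    (H : ∀ l, 1 ≤ l → l < t → μ * Q l ≠ 0 → h l ω = h' l ω) :
    riskMean m γ A Q μ Y h t ω = riskMean m γ A Q μ Y h' t ω := by
  refine predictor_congr fun l h1 h2 => ?_
  rw [tiltCoeff, tiltCoeff]
  by_cases hl : μ * Q l = 0
  · simp [hl]
  · rw [H l h1 h2 hl]

/-- Estimates which are optimal in the nondegenerate directions agree with the filter there. -/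
lemma eq_of_forall_eq_riskEstimate {Ω : Type*} {m : ℕ → ℝ} {γ : ℕ → ℕ → ℝ} {A Q : ℕ → ℝ} {μ : ℝ}
    {Y h h' : ℕ → Ω → ℝ} {n : ℕ} {ω : Ω}
    (H : ∀ t, 1 ≤ t → t ≤ n → μ * Q t ≠ 0 → h t ω = riskEstimate m γ A Q μ Y h t ω)
    (H' : ∀ t, 1 ≤ t → t ≤ n → μ * Q t ≠ 0 → h' t ω = riskEstimate m γ A Q μ Y h' t ω) :
    ∀ t, 1 ≤ t → t ≤ n → μ * Q t ≠ 0 → h t ω = h' t ω := by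
  intro t
  induction t using Nat.strong_induction_on with
  | _ t ih =>
    intro h1 h2 hQ
    rw [H t h1 h2 hQ, H' t h1 h2 hQ, riskEstimate, riskEstimate,
      riskMean_congr fun l hl1 hl2 hl3 => ih l hl2 hl1 (by omega) hl3]

section
variable {Ω : Type*} {m : ℕ → ℝ} {γ : ℕ → ℕ → ℝ} {A Q : ℕ → ℝ} {μ : ℝ} {n : ℕ}
  {Y h : ℕ → Ω → ℝ}

/-- Multiplication by μ turns the signed weight into one with μ², treating both signs of μ together.
-/
lemma mul_riskLoss_term_nonneg (hQ : ∀ t, 1 ≤ t → 0 ≤ Q t)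
    (hγ0 : ∀ l, 1 ≤ l → l ≤ n → 0 ≤ γ l l)
    (hS : ∀ l, 1 ≤ l → l ≤ n → 0 < 1 + weight A Q μ l * γ l l) (ω : Ω) {t : ℕ}
    (ht : t ∈ Finset.Ico 1 (n + 1)) :
    0 ≤ μ * (μ * Q t * (1 + A t ^ 2 * γ t t) / (2 * (1 + weight A Q μ t * γ t t)) *
      (h t ω - riskEstimate m γ A Q μ Y h t ω) ^ 2) := by
  obtain ⟨h1, h2⟩ := Finset.mem_Ico.1 ht
  have hD := hS t h1 (by omega)
  have hγt := hγ0 t h1 (by omega)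
  have hQt := hQ t h1
  rw [show ∀ x : ℝ, μ * (μ * Q t * (1 + A t ^ 2 * γ t t) / (2 * (1 + weight A Q μ t * γ t t)) * x) =
    μ ^ 2 * Q t * (1 + A t ^ 2 * γ t t) / (2 * (1 + weight A Q μ t * γ t t)) * x from
    fun x => by ring]
  positivity

lemma mul_riskLoss_nonneg (hQ : ∀ t, 1 ≤ t → 0 ≤ Q t)
    (hγ0 : ∀ l, 1 ≤ l → l ≤ n → 0 ≤ γ l l)
    (hS : ∀ l, 1 ≤ l → l ≤ n → 0 < 1 + weight A Q μ l * γ l l) (ω : Ω) :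
    0 ≤ μ * riskLoss m γ A Q μ Y h n ω := by
  rw [riskLoss, Finset.mul_sum]
  exact Finset.sum_nonneg fun t ht => mul_riskLoss_term_nonneg hQ hγ0 hS ω ht

lemma eq_riskEstimate_of_riskLoss_eq_zero (hQ : ∀ t, 1 ≤ t → 0 ≤ Q t)
    (hγ0 : ∀ l, 1 ≤ l → l ≤ n → 0 ≤ γ l l)
    (hS : ∀ l, 1 ≤ l → l ≤ n → 0 < 1 + weight A Q μ l * γ l l) {ω : Ω}
    (h0 : riskLoss m γ A Q μ Y h n ω = 0) {t : ℕ} (h1 : 1 ≤ t) (h2 : t ≤ n) (hQt : μ * Q t ≠ 0) :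
    h t ω = riskEstimate m γ A Q μ Y h t ω := by
  have h3 : μ * riskLoss m γ A Q μ Y h n ω = 0 := by rw [h0, mul_zero]
  rw [riskLoss, Finset.mul_sum,
    Finset.sum_eq_zero_iff_of_nonneg fun t ht => mul_riskLoss_term_nonneg hQ hγ0 hS ω ht] at h3
  have h4 := h3 t (Finset.mem_Ico.2 ⟨h1, by omega⟩)
  have hD := hS t h1 h2
  have hE : 0 < 1 + A t ^ 2 * γ t t := by have := hγ0 t h1 h2; positivity
  have hμ : μ ≠ 0 := left_ne_zero_of_mul hQt
  have h5 : μ * Q t * (1 + A t ^ 2 * γ t t) / (2 * (1 + weight A Q μ t * γ t t)) ≠ 0 :=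
    div_ne_zero (mul_ne_zero hQt hE.ne') (by positivity)
  have h6 := (mul_eq_zero.1 ((mul_eq_zero.1 h4).resolve_left hμ)).resolve_left h5
  exact sub_eq_zero.1 (pow_eq_zero_iff two_ne_zero |>.1 h6)

lemma IsFilterSolution.riskLoss_eq_zero (hh : IsFilterSolution m A γ Y n h)
    (hγ0 : ∀ l, 1 ≤ l → l ≤ n → 0 ≤ γ l l)
    (hS : ∀ l, 1 ≤ l → l ≤ n → 0 < 1 + weight A Q μ l * γ l l) (ω : Ω) :
    riskLoss m γ A Q μ Y h n ω = 0 := by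
  refine Finset.sum_eq_zero fun t ht => ?_
  obtain ⟨h1, h2⟩ := Finset.mem_Ico.1 ht
  rw [← hh.eq_riskEstimate hγ0 hS ω t h1 (by omega)]
  simp

/-- The recursion is implicit in h_t. Moving the term l = t to the left gives h_t the coefficient 1
+ A_t² γ(t,t) > 0, which makes the recursion explicit; uniqueness and adaptedness follow by
induction. -/
lemma IsFilterSolution.eq_div (hh : IsFilterSolution m A γ Y n h)
    (hγ0 : ∀ l, 1 ≤ l → l ≤ n → 0 ≤ γ l l) {t : ℕ} (h1 : 1 ≤ t) (h2 : t ≤ n) (ω : Ω) :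
    h t ω = (m t + ∑ l ∈ Finset.Ico 1 t, A l * γ t l * (Y l ω - A l * h l ω) +
      A t * γ t t * Y t ω) / (1 + A t ^ 2 * γ t t) := by
  have hE : 0 < 1 + A t ^ 2 * γ t t := by have := hγ0 t h1 h2; positivity
  have := hh t h1 h2 ω
  rw [Icc_one_eq_Ico, Finset.sum_Ico_succ_top h1] at this
  rw [eq_div_iff hE.ne']
  linear_combination this

lemma IsFilterSolution.unique {h' : ℕ → Ω → ℝ} (hh : IsFilterSolution m A γ Y n h)
    (hh' : IsFilterSolution m A γ Y n h') (hγ0 : ∀ l, 1 ≤ l → l ≤ n → 0 ≤ γ l l) :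
    ∀ t, 1 ≤ t → t ≤ n → h' t = h t := by
  intro t
  induction t using Nat.strong_induction_on with
  | _ t ih =>
    intro h1 h2
    funext ω
    rw [hh.eq_div hγ0 h1 h2, hh'.eq_div hγ0 h1 h2]
    congr 3
    refine Finset.sum_congr rfl fun l hl => ?_
    obtain ⟨hl1, hl2⟩ := Finset.mem_Ico.1 hl
    rw [ih l hl2 hl1 (by omega)]

lemma IsFilterSolution.isObsAdapted (hh : IsFilterSolution m A γ Y n h)
    (hγ0 : ∀ l, 1 ≤ l → l ≤ n → 0 ≤ γ l l) : IsObsAdapted Y n h := by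
  intro t
  induction t using Nat.strong_induction_on with
  | _ t ih =>
    intro h1 h2
    rw [funext fun ω => hh.eq_div hγ0 h1 h2 ω]
    refine Measurable.div_const (Measurable.add (Measurable.add measurable_const
      (Finset.measurable_fun_sum _ fun l hl => ?_))
      ((measurable_obsField Y h1 le_rfl).const_mul _)) _
    obtain ⟨hl1, hl2⟩ := Finset.mem_Ico.1 hl
    exact ((measurable_obsField Y hl1 hl2.le).sub (((ih l hl2 hl1 (by omega)).mono
      (obsField_mono Y hl2.le) le_rfl).const_mul _)).const_mul _

end

/-- The solution of the filtering recursion driven by the observations `y`. -/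
noncomputable def filterRec (m A : ℕ → ℝ) (γ : ℕ → ℕ → ℝ) (y : ℕ → ℝ) (t : ℕ) : ℝ :=
  (m t + ∑ l : Finset.Ico 1 t, A l * γ t l * (y l - A l * filterRec m A γ y l) +
    A t * γ t t * y t) / (1 + A t ^ 2 * γ t t)
termination_by t
decreasing_by exact (Finset.mem_Ico.1 l.2).2

lemma isFilterSolution_filterRec {Ω : Type*} {m A : ℕ → ℝ} {γ : ℕ → ℕ → ℝ} {Y : ℕ → Ω → ℝ} {n : ℕ}
    (hγ0 : ∀ l, 1 ≤ l → l ≤ n → 0 ≤ γ l l) :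
    IsFilterSolution m A γ Y n fun t ω => filterRec m A γ (fun l => Y l ω) t := by
  intro t h1 h2 ω
  have hE : 0 < 1 + A t ^ 2 * γ t t := by have := hγ0 t h1 h2; positivity
  have h := filterRec.eq_1 m A γ (fun l => Y l ω) t
  rw [Finset.sum_coe_sort (Finset.Ico 1 t)
    fun l => A l * γ t l * (Y l ω - A l * filterRec m A γ (fun l => Y l ω) l),
    eq_div_iff hE.ne'] at h
  simp only [Icc_one_eq_Ico, Finset.sum_Ico_succ_top h1]
  linear_combination h

/-! ### Optimal value and the case of equality -/

section
variable {Ω : Type*} [MeasurableSpace Ω] {P : Measure Ω} [IsProbabilityMeasure P]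
  {X ε : ℕ → Ω → ℝ} {m : ℕ → ℝ} {K γ : ℕ → ℕ → ℝ} {A Q : ℕ → ℝ} {μ : ℝ} {n : ℕ}
  {h hbar : ℕ → Ω → ℝ}

/-- The density depends on `h` but its integral does not, so each `h` can be compared pointwise with
its own zero-loss density. -/
lemma lintegral_optimal_density (hmodel : IsSignalModel P X ε m K)
    (hγ0 : ∀ l, 1 ≤ l → l ≤ n → 0 ≤ γ l l) (hh : IsObsAdapted (obs A X ε) n h) :
    ∫⁻ ω, ENNReal.ofReal (tiltConst γ (weight A Q μ) n *
        Real.exp (∑ t ∈ Finset.Ico 1 (n + 1), logLik (A t) (γ t t)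
          (riskMean m γ A Q μ (obs A X ε) h t ω) (obs A X ε t ω))) ∂(refMeasure P A X ε n) =
      optimalRisk γ A Q μ n := by
  have hC : 0 ≤ tiltConst γ (weight A Q μ) n := Finset.prod_nonneg fun _ _ => by positivity
  simp_rw [ENNReal.ofReal_mul hC]
  rw [lintegral_const_mul' _ _ ENNReal.ofReal_ne_top, lintegral_exp_sum_logLik hmodel hγ0
    (fun k hk => measurable_riskMean hh hk.le) le_rfl, optimalRisk]

lemma expRisk_filter (hmodel : IsSignalModel P X ε m K)
    (hγ : IsGammaSolution K A Q μ n γ) (hγ0 : ∀ l, 1 ≤ l → l ≤ n → 0 ≤ γ l l)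
    (hS : ∀ l, 1 ≤ l → l ≤ n → 0 < 1 + weight A Q μ l * γ l l)
    (hbar_sol : IsFilterSolution m A γ (obs A X ε) n hbar) :
    expRisk P X Q μ n hbar = optimalRisk γ A Q μ n := by
  have hh := hbar_sol.isObsAdapted hγ0
  rw [expRisk, lintegral_exp_risk hmodel hγ hγ0 hS hh]
  simp only [hbar_sol.riskLoss_eq_zero hγ0 hS, Real.exp_zero, ENNReal.ofReal_one, mul_one]
  exact lintegral_optimal_density hmodel hγ0 hh

lemma optimalRisk_le_expRisk (hmodel : IsSignalModel P X ε m K) (hQ : ∀ t, 1 ≤ t → 0 ≤ Q t)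
    (hγ : IsGammaSolution K A Q μ n γ) (hγ0 : ∀ l, 1 ≤ l → l ≤ n → 0 ≤ γ l l)
    (hS : ∀ l, 1 ≤ l → l ≤ n → 0 < 1 + weight A Q μ l * γ l l)
    (hh : IsObsAdapted (obs A X ε) n h) (hμ : 0 < μ) :
    optimalRisk γ A Q μ n ≤ expRisk P X Q μ n h := by
  rw [expRisk, lintegral_exp_risk hmodel hγ hγ0 hS hh,
    ← lintegral_optimal_density (m := m) (Q := Q) hmodel hγ0 hh]
  refine lintegral_mono fun ω => le_mul_of_one_le_right' ?_
  rw [← ENNReal.ofReal_one]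
  exact ENNReal.ofReal_le_ofReal
    (Real.one_le_exp (nonneg_of_mul_nonneg_right (mul_riskLoss_nonneg hQ hγ0 hS ω) hμ))

lemma expRisk_le_optimalRisk (hmodel : IsSignalModel P X ε m K) (hQ : ∀ t, 1 ≤ t → 0 ≤ Q t)
    (hγ : IsGammaSolution K A Q μ n γ) (hγ0 : ∀ l, 1 ≤ l → l ≤ n → 0 ≤ γ l l)
    (hS : ∀ l, 1 ≤ l → l ≤ n → 0 < 1 + weight A Q μ l * γ l l)
    (hh : IsObsAdapted (obs A X ε) n h) (hμ : μ < 0) :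
    expRisk P X Q μ n h ≤ optimalRisk γ A Q μ n := by
  rw [expRisk, lintegral_exp_risk hmodel hγ hγ0 hS hh,
    ← lintegral_optimal_density (m := m) (Q := Q) hmodel hγ0 hh]
  refine lintegral_mono fun ω => mul_le_of_le_one_right' ?_
  rw [← ENNReal.ofReal_one]
  exact ENNReal.ofReal_le_ofReal
    (Real.exp_le_one_iff.2 (nonpos_of_mul_nonneg_right (mul_riskLoss_nonneg hQ hγ0 hS ω) hμ))

/-- An adapted sequence attaining the optimal value agrees with the filter wherever the criterion
is not degenerate. -/
lemma ae_eq_filter_of_expRisk_eq (hmodel : IsSignalModel P X ε m K) (hQ : ∀ t, 1 ≤ t → 0 ≤ Q t)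
    (hγ : IsGammaSolution K A Q μ n γ) (hγ0 : ∀ l, 1 ≤ l → l ≤ n → 0 ≤ γ l l)
    (hS : ∀ l, 1 ≤ l → l ≤ n → 0 < 1 + weight A Q μ l * γ l l)
    (hbar_sol : IsFilterSolution m A γ (obs A X ε) n hbar)
    (hh : IsObsAdapted (obs A X ε) n h) (hopt : expRisk P X Q μ n h = optimalRisk γ A Q μ n) :
    ∀ t, 1 ≤ t → t ≤ n → μ * Q t ≠ 0 → h t =ᵐ[P] hbar t := by
  intro t0 h10 h20 hQ0
  have hμ0 : μ ≠ 0 := left_ne_zero_of_mul hQ0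
  set Y := obs A X ε with hY
  set M : Ω → ℝ := fun ω => tiltConst γ (weight A Q μ) n *
    Real.exp (∑ t ∈ Finset.Ico 1 (n + 1), logLik (A t) (γ t t)
      (riskMean m γ A Q μ Y h t ω) (Y t ω)) with hM
  have hCpos : 0 < tiltConst γ (weight A Q μ) n := Finset.prod_pos fun r hr => by
    have := hS r (Finset.mem_Ico.1 hr).1 (by have := (Finset.mem_Ico.1 hr).2; omega)
    positivity
  have hMpos : ∀ ω, ENNReal.ofReal (M ω) ≠ 0 := fun ω => by
    simp only [ne_eq, ENNReal.ofReal_eq_zero, not_le, hM]; positivity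
  have hmean : ∀ t ∈ Finset.Ico 1 (n + 1), Measurable (riskMean m γ A Q μ Y h t) := fun t ht => by
    obtain ⟨u, rfl⟩ := Nat.exists_eq_add_of_le' (Finset.mem_Ico.1 ht).1
    have hu : u ≤ n := by have := (Finset.mem_Ico.1 ht).2; omega
    exact (measurable_riskMean hh hu).mono (obsField_le hmodel A u) le_rfl
  have hYm : ∀ t ∈ Finset.Ico 1 (n + 1), Measurable (Y t) := fun t ht =>
    measurable_obs hmodel A t (Finset.mem_Ico.1 ht).1
  have hhm : ∀ t ∈ Finset.Ico 1 (n + 1), Measurable (h t) := fun t ht =>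
    (hh t (Finset.mem_Ico.1 ht).1 (by have := (Finset.mem_Ico.1 ht).2; omega)).mono
      (obsField_le hmodel A t) le_rfl
  have hMm : Measurable M := measurable_const.mul (Finset.measurable_fun_sum _ fun t ht =>
    measurable_logLik _ _ (hmean t ht) (hYm t ht)).exp
  have hLm : Measurable (riskLoss m γ A Q μ Y h n) := Finset.measurable_fun_sum _ fun t ht =>
    (((hhm t ht).sub (((hmean t ht).add ((hYm t ht).const_mul _)).div_const _)).pow_const
      2).const_mul _
  have hVal := lintegral_optimal_density (m := m) (Q := Q) (μ := μ) hmodel hγ0 hh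
  have hopt' := hopt
  rw [expRisk, lintegral_exp_risk hmodel hγ hγ0 hS hh] at hopt'
  have hfin := optimalRisk_ne_top γ A Q μ n
  -- The two integrands are ordered pointwise, in a direction given by the sign of μ, and have the
  -- same finite integral.
  have hae : (fun ω => ENNReal.ofReal (M ω)) =ᵐ[refMeasure P A X ε n] fun ω =>
      ENNReal.ofReal (M ω) * ENNReal.ofReal (Real.exp (riskLoss m γ A Q μ Y h n ω)) := by
    rcases hμ0.lt_or_gt with hμ | hμ
    · refine (ae_eq_of_ae_le_of_lintegral_le (ae_of_all _ fun ω => mul_le_of_le_one_right' ?_)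
        (by rw [hopt']; exact hfin) hMm.ennreal_ofReal.aemeasurable
        (by rw [hopt', hVal])).symm
      rw [← ENNReal.ofReal_one]
      exact ENNReal.ofReal_le_ofReal
        (Real.exp_le_one_iff.2 (nonpos_of_mul_nonneg_right (mul_riskLoss_nonneg hQ hγ0 hS ω) hμ))
    · refine ae_eq_of_ae_le_of_lintegral_le (ae_of_all _ fun ω => le_mul_of_one_le_right' ?_)
        (by rw [hVal]; exact hfin)
        (hMm.ennreal_ofReal.mul hLm.exp.ennreal_ofReal).aemeasurable
        (by rw [hopt', hVal])
      rw [← ENNReal.ofReal_one]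
      exact ENNReal.ofReal_le_ofReal
        (Real.one_le_exp (nonneg_of_mul_nonneg_right (mul_riskLoss_nonneg hQ hγ0 hS ω) hμ))
  -- The reference density never vanishes, so almost-sure statements return to `P`.
  have hac : P ≪ refMeasure P A X ε n :=
    withDensity_absolutelyContinuous' (measurable_refDensity hmodel A n).exp.ennreal_ofReal.aemeasurable
      (ae_of_all _ fun ω => by simp [Real.exp_pos])
  filter_upwards [hac.ae_le hae] with ω hω
  have h1 : ENNReal.ofReal (Real.exp (riskLoss m γ A Q μ Y h n ω)) = 1 := by
    have h2 : ENNReal.ofReal (M ω) * 1 =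
      ENNReal.ofReal (M ω) * ENNReal.ofReal (Real.exp (riskLoss m γ A Q μ Y h n ω)) := by
      rw [mul_one]; exact hω
    exact ((ENNReal.mul_right_inj (hMpos ω) ENNReal.ofReal_ne_top).1 h2).symm
  have h2 : riskLoss m γ A Q μ Y h n ω = 0 := by
    rw [ENNReal.ofReal_eq_one] at h1
    exact (Real.exp_eq_one_iff _).1 h1
  exact eq_of_forall_eq_riskEstimate (n := n)
    (fun t h1 h3 h4 => eq_riskEstimate_of_riskLoss_eq_zero hQ hγ0 hS h2 h1 h3 h4)
    (fun t h1 h3 _ => hbar_sol.eq_riskEstimate hγ0 hS ω t h1 h3) t0 h10 h20 hQ0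

end

/-! ### Reduction of both criteria to nonnegative integrals -/

/-- This identifies the RS exponent at time t with a LEG exponent of horizon t whose last estimate
is replaced by `g`. -/
lemma rs_exponent_eq {Ω : Type*} {X h : ℕ → Ω → ℝ} {Q : ℕ → ℝ} {μ : ℝ} {t : ℕ} {g : Ω → ℝ}
    (ht : 1 ≤ t) (ω : Ω) :
    μ / 2 * (X t ω - g ω) ^ 2 * Q t + μ / 2 * ∑ s ∈ Finset.Ico 1 t, (X s ω - h s ω) ^ 2 * Q s =
      μ / 2 * ∑ s ∈ Finset.Icc 1 t, (X s ω - Function.update h t g s ω) ^ 2 * Q s := by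
  rw [Icc_one_eq_Ico, Finset.sum_Ico_succ_top ht, Function.update_self]
  have : ∑ s ∈ Finset.Ico 1 t, (X s ω - Function.update h t g s ω) ^ 2 * Q s =
      ∑ s ∈ Finset.Ico 1 t, (X s ω - h s ω) ^ 2 * Q s :=
    Finset.sum_congr rfl fun s hs => by
      rw [Function.update_of_ne (by have := (Finset.mem_Ico.1 hs).2; omega)]
  rw [this]
  ring

lemma IsObsAdapted.update {Ω : Type*} {Y h : ℕ → Ω → ℝ} {n : ℕ} (hh : IsObsAdapted Y n h)
    {g : Ω → ℝ}
    (hg : Measurable[obsField Y n] g) : IsObsAdapted Y n (Function.update h n g) := by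
  intro s h1 h2
  rcases h2.eq_or_lt with rfl | h3
  · simpa using hg
  · rw [Function.update_of_ne h3.ne]; exact hh s h1 h2

section
variable {Ω : Type*} [MeasurableSpace Ω] {P : Measure Ω} {X Y : ℕ → Ω → ℝ} {Q : ℕ → ℝ} {μ : ℝ}
  {n t : ℕ} {h h' : ℕ → Ω → ℝ} {g g' : Ω → ℝ}

/-- The integrand has the sign of μ, so one part of the extended expectation vanishes. For μ < 0 the
remaining minus sign turns minimisation into maximisation of `expRisk`. -/
lemma legCost_of_pos (hμ : 0 < μ) :
    legCost P X Q μ n h = ((ENNReal.ofReal μ * expRisk P X Q μ n h : ℝ≥0∞) : EReal) := by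
  have h2 : ∀ x, ENNReal.ofReal (-(μ * Real.exp x)) = 0 := fun x => by
    rw [ENNReal.ofReal_eq_zero]; have := Real.exp_pos x; nlinarith
  simp only [legCost, extExp, h2, ENNReal.ofReal_mul hμ.le]
  rw [lintegral_const_mul' _ _ ENNReal.ofReal_ne_top]
  simp [expRisk]

lemma legCost_of_neg (hμ : μ < 0) :
    legCost P X Q μ n h = -((ENNReal.ofReal (-μ) * expRisk P X Q μ n h : ℝ≥0∞) : EReal) := by
  have h2 : ∀ x, ENNReal.ofReal (μ * Real.exp x) = 0 := fun x => by
    rw [ENNReal.ofReal_eq_zero]; have := Real.exp_pos x; nlinarith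
  simp only [legCost, extExp, h2, ← neg_mul, ENNReal.ofReal_mul (neg_nonneg.2 hμ.le)]
  rw [lintegral_const_mul' _ _ ENNReal.ofReal_ne_top]
  simp [expRisk]

lemma legCost_le_iff_of_pos (hμ : 0 < μ) :
    legCost P X Q μ n h ≤ legCost P X Q μ n h' ↔ expRisk P X Q μ n h ≤ expRisk P X Q μ n h' := by
  rw [legCost_of_pos hμ, legCost_of_pos hμ, EReal.coe_ennreal_le_coe_ennreal_iff,
    ENNReal.mul_le_mul_iff_right (by simpa using hμ) ENNReal.ofReal_ne_top]

lemma legCost_le_iff_of_neg (hμ : μ < 0) :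
    legCost P X Q μ n h ≤ legCost P X Q μ n h' ↔ expRisk P X Q μ n h' ≤ expRisk P X Q μ n h := by
  rw [legCost_of_neg hμ, legCost_of_neg hμ, EReal.neg_le_neg_iff,
    EReal.coe_ennreal_le_coe_ennreal_iff,
    ENNReal.mul_le_mul_iff_right (by simpa using hμ) ENNReal.ofReal_ne_top]

lemma legCost_of_eq_zero (hμ : μ = 0) : legCost P X Q μ n h = 0 := by
  simp [legCost, extExp, hμ]

/-- The integrand of `expRisk`. -/
noncomputable def riskIntegrand (X : ℕ → Ω → ℝ) (Q : ℕ → ℝ) (μ : ℝ) (n : ℕ) (h : ℕ → Ω → ℝ)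
    (ω : Ω) : ℝ≥0∞ :=
  ENNReal.ofReal (Real.exp (μ / 2 * ∑ t ∈ Finset.Icc 1 n, (X t ω - h t ω) ^ 2 * Q t))

lemma rsCost_of_pos (hμ : 0 < μ) (ht : 1 ≤ t) (ω : Ω) :
    rsCost P X Y Q μ h t g ω = ((condLExp (obsField Y t) P (fun ω => ENNReal.ofReal μ *
      riskIntegrand X Q μ t (Function.update h t g) ω) ω : ℝ≥0∞) : EReal) := by
  have h2 : ∀ x, ENNReal.ofReal (-(μ * Real.exp x)) = 0 := fun x => by
    rw [ENNReal.ofReal_eq_zero]; have := Real.exp_pos x; nlinarith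
  have h3 : condLExp (obsField Y t) P (fun _ : Ω => (0 : ℝ≥0∞)) ω = 0 := by
    have := congrFun (condLExp_zero (mΩ := obsField Y t) P) ω
    exact this
  simp only [rsCost, extCondExp, h2, h3, ENNReal.ofReal_mul hμ.le, rs_exponent_eq ht,
    riskIntegrand]
  simp

lemma rsCost_of_neg (hμ : μ < 0) (ht : 1 ≤ t) (ω : Ω) :
    rsCost P X Y Q μ h t g ω = -((condLExp (obsField Y t) P (fun ω => ENNReal.ofReal (-μ) *
      riskIntegrand X Q μ t (Function.update h t g) ω) ω : ℝ≥0∞) : EReal) := by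
  have h2 : ∀ x, ENNReal.ofReal (μ * Real.exp x) = 0 := fun x => by
    rw [ENNReal.ofReal_eq_zero]; have := Real.exp_pos x; nlinarith
  have h3 : condLExp (obsField Y t) P (fun _ : Ω => (0 : ℝ≥0∞)) ω = 0 := by
    have := congrFun (condLExp_zero (mΩ := obsField Y t) P) ω
    exact this
  simp only [rsCost, extCondExp, h2, h3, ← neg_mul, ENNReal.ofReal_mul (neg_nonneg.2 hμ.le),
    riskIntegrand]
  simp only [rs_exponent_eq ht]
  simp

lemma rsCost_of_eq_zero (hμ : μ = 0) (ω : Ω) : rsCost P X Y Q μ h t g ω = 0 := by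
  have h3 : condLExp (obsField Y t) P (fun _ : Ω => (0 : ℝ≥0∞)) ω = 0 := by
    have := congrFun (condLExp_zero (mΩ := obsField Y t) P) ω
    exact this
  simp [rsCost, extCondExp, hμ, h3]

/-- The integrands of the criteria do not see the estimates in degenerate directions. -/
lemma riskIntegrand_ae_eq (H : ∀ s, 1 ≤ s → s ≤ n → μ * Q s ≠ 0 → h s =ᵐ[P] h' s) :
    riskIntegrand X Q μ n h =ᵐ[P] riskIntegrand X Q μ n h' := by
  have H' : ∀ᵐ ω ∂P, ∀ s, 1 ≤ s → s ≤ n → μ * Q s ≠ 0 → h s ω = h' s ω := by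
    rw [ae_all_iff]
    intro s
    by_cases h1 : 1 ≤ s
    · by_cases h2 : s ≤ n
      · by_cases h3 : μ * Q s = 0
        · simp [h3]
        · filter_upwards [H s h1 h2 h3] with ω hω _ _ _ using hω
      · simp [h2]
    · simp [h1]
  filter_upwards [H'] with ω hω
  simp only [riskIntegrand, Finset.mul_sum]
  congr 2
  refine Finset.sum_congr rfl fun s hs => ?_
  obtain ⟨h1, h2⟩ := Finset.mem_Icc.1 hs
  by_cases h3 : μ * Q s = 0
  · linear_combination ((X s ω - h s ω) ^ 2 - (X s ω - h' s ω) ^ 2) / 2 * h3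
  · rw [hω s h1 h2 h3]

lemma expRisk_congr (H : ∀ s, 1 ≤ s → s ≤ n → μ * Q s ≠ 0 → h s =ᵐ[P] h' s) :
    expRisk P X Q μ n h = expRisk P X Q μ n h' :=
  lintegral_congr_ae (riskIntegrand_ae_eq H)

lemma legCost_congr (H : ∀ s, 1 ≤ s → s ≤ n → μ * Q s ≠ 0 → h s =ᵐ[P] h' s) :
    legCost P X Q μ n h = legCost P X Q μ n h' := by
  rcases lt_trichotomy μ 0 with hμ | hμ | hμ
  · rw [legCost_of_neg hμ, legCost_of_neg hμ, expRisk_congr H]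
  · rw [legCost_of_eq_zero hμ, legCost_of_eq_zero hμ]
  · rw [legCost_of_pos hμ, legCost_of_pos hμ, expRisk_congr H]

lemma rsCost_congr (ht : 1 ≤ t) (H : ∀ s, 1 ≤ s → s < t → μ * Q s ≠ 0 → h s =ᵐ[P] h' s)
    (Hg : μ * Q t ≠ 0 → g =ᵐ[P] g') :
    rsCost P X Y Q μ h t g =ᵐ[P] rsCost P X Y Q μ h' t g' := by
  have hae : riskIntegrand X Q μ t (Function.update h t g) =ᵐ[P]
      riskIntegrand X Q μ t (Function.update h' t g') := by
    refine riskIntegrand_ae_eq fun s h1 h2 h3 => ?_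
    rcases h2.eq_or_lt with rfl | h2
    · simpa using Hg h3
    · rw [Function.update_of_ne h2.ne, Function.update_of_ne h2.ne]
      exact H s h1 h2 h3
  rcases lt_trichotomy μ 0 with hμ | hμ | hμ
  · have := condLExp_congr_ae (mΩ := obsField Y t)
      (hae.mono fun ω hω => congrArg (fun x => ENNReal.ofReal (-μ) * x) hω)
    filter_upwards [this] with ω hω
    rw [rsCost_of_neg hμ ht, rsCost_of_neg hμ ht, hω]
  · exact ae_of_all _ fun ω => by rw [rsCost_of_eq_zero hμ, rsCost_of_eq_zero hμ]
  · have := condLExp_congr_ae (mΩ := obsField Y t)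
      (hae.mono fun ω hω => congrArg (fun x => ENNReal.ofReal μ * x) hω)
    filter_upwards [this] with ω hω
    rw [rsCost_of_pos hμ ht, rsCost_of_pos hμ ht, hω]

end

/-! ### From LEG optimality to conditional optimality -/

lemma condLExp_le_of_forall_setLIntegral_le {Ω : Type*} {m m0 : MeasurableSpace Ω} (hm : m ≤ m0)
    {P : Measure[m0] Ω} [IsFiniteMeasure P] {f g : Ω → ℝ≥0∞}
    (h : ∀ s, MeasurableSet[m] s → ∫⁻ ω in s, f ω ∂P ≤ ∫⁻ ω in s, g ω ∂P) :
    condLExp m P f ≤ᵐ[P] condLExp m P g := by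
  refine ae_le_of_ae_le_trim (hm := hm) ?_
  refine ae_le_of_forall_setLIntegral_le_of_sigmaFinite (μ := P.trim hm)
    (measurable_condLExp m P f) fun s hs _ => ?_
  rw [setLIntegral_condLExp_trim hm _ _ hs, setLIntegral_condLExp_trim hm _ _ hs]
  exact h s hs

section
variable {Ω : Type*} [MeasurableSpace Ω] {P : Measure Ω}
  {X ε : ℕ → Ω → ℝ} {m : ℕ → ℝ} {K γ : ℕ → ℕ → ℝ} {A Q : ℕ → ℝ} {μ : ℝ} {n T : ℕ}
  {h hbar : ℕ → Ω → ℝ}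

/-- Pasting a competitor on an observable event changes the risk only on that event. -/
lemma setLIntegral_riskIntegrand_add (hmodel : IsSignalModel P X ε m K) {g : Ω → ℝ} {B : Set Ω}
    [DecidablePred (· ∈ B)] (hB : MeasurableSet[obsField (obs A X ε) n] B) :
    expRisk P X Q μ n (Function.update hbar n (B.piecewise g (hbar n))) =
      ∫⁻ ω in B, riskIntegrand X Q μ n (Function.update hbar n g) ω ∂P +
        ∫⁻ ω in Bᶜ, riskIntegrand X Q μ n hbar ω ∂P := by
  have hB' : MeasurableSet B := obsField_le hmodel A n B hB
  have hcongr : ∀ (u v : ℕ → Ω → ℝ) (ω : Ω), (∀ s, u s ω = v s ω) →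
      riskIntegrand X Q μ n u ω = riskIntegrand X Q μ n v ω := fun u v ω huv => by
    simp only [riskIntegrand, huv]
  rw [expRisk, ← lintegral_add_compl _ hB']
  congr 1
  · refine setLIntegral_congr_fun hB' fun ω hω => hcongr _ _ ω fun s => ?_
    rcases eq_or_ne s n with rfl | hs
    · simp [hω]
    · simp [Function.update_of_ne hs]
  · refine setLIntegral_congr_fun hB'.compl fun ω hω => hcongr _ _ ω fun s => ?_
    rcases eq_or_ne s n with rfl | hs
    · simp [Set.piecewise_eq_of_notMem _ _ _ hω]
    · simp [Function.update_of_ne hs]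

variable [IsProbabilityMeasure P]

/-- On each observable `B`, the filter is compared with the sequence using `g` on `B` and the filter
elsewhere. Finiteness of the optimal value allows the common contribution of `Bᶜ` to be cancelled,
leaving the inequality of integrals over `B` that characterises the conditional one. -/
lemma rsCost_filter_le (hmodel : IsSignalModel P X ε m K) (hQ : ∀ t, 1 ≤ t → 0 ≤ Q t)
    (hγ : IsGammaSolution K A Q μ n γ) (hγ0 : ∀ l, 1 ≤ l → l ≤ n → 0 ≤ γ l l)
    (hS : ∀ l, 1 ≤ l → l ≤ n → 0 < 1 + weight A Q μ l * γ l l)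
    (hbar_sol : IsFilterSolution m A γ (obs A X ε) n hbar) (hn : 1 ≤ n) {g : Ω → ℝ}
    (hg : Measurable[obsField (obs A X ε) n] g) :
    rsCost P X (obs A X ε) Q μ hbar n (hbar n) ≤ᵐ[P] rsCost P X (obs A X ε) Q μ hbar n g := by
  classical
  have hbar_ad := hbar_sol.isObsAdapted hγ0
  have hopt := expRisk_filter hmodel hγ hγ0 hS hbar_sol
  have hfin : expRisk P X Q μ n hbar ≠ ∞ := by rw [hopt]; exact optimalRisk_ne_top _ _ _ _ _
  have hupd : ∀ B, MeasurableSet[obsField (obs A X ε) n] B →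
      IsObsAdapted (obs A X ε) n (Function.update hbar n (B.piecewise g (hbar n))) := fun B hB =>
    hbar_ad.update (Measurable.piecewise hB hg (hbar_ad n hn le_rfl))
  have hsplit : ∀ B, MeasurableSet[obsField (obs A X ε) n] B → expRisk P X Q μ n hbar =
      ∫⁻ ω in B, riskIntegrand X Q μ n hbar ω ∂P +
        ∫⁻ ω in Bᶜ, riskIntegrand X Q μ n hbar ω ∂P := fun B hB =>
    (lintegral_add_compl _ (obsField_le hmodel A n B hB)).symm
  have hcfin : ∀ B, MeasurableSet[obsField (obs A X ε) n] B →
      ∫⁻ ω in Bᶜ, riskIntegrand X Q μ n hbar ω ∂P ≠ ∞ := fun B hB h0 => by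
    rw [hsplit B hB, h0, add_top] at hfin; exact hfin rfl
  rcases lt_trichotomy μ 0 with hμ | hμ | hμ
  · have hle := condLExp_le_of_forall_setLIntegral_le (obsField_le hmodel A n) (P := P)
      (f := fun ω => ENNReal.ofReal (-μ) * riskIntegrand X Q μ n (Function.update hbar n g) ω)
      (g := fun ω => ENNReal.ofReal (-μ) *
        riskIntegrand X Q μ n (Function.update hbar n (hbar n)) ω) fun B hB => by
      rw [lintegral_const_mul' _ _ ENNReal.ofReal_ne_top,
        lintegral_const_mul' _ _ ENNReal.ofReal_ne_top, Function.update_eq_self]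
      refine mul_le_mul_right ?_ _
      have := expRisk_le_optimalRisk hmodel hQ hγ hγ0 hS (hupd B hB) hμ
      rw [← hopt, setLIntegral_riskIntegrand_add hmodel hB, hsplit B hB] at this
      exact (ENNReal.add_le_add_iff_right (hcfin B hB)).1 this
    filter_upwards [hle] with ω hω
    rw [rsCost_of_neg hμ hn, rsCost_of_neg hμ hn, EReal.neg_le_neg_iff,
      EReal.coe_ennreal_le_coe_ennreal_iff]
    exact hω
  · exact ae_of_all _ fun ω => by rw [rsCost_of_eq_zero hμ, rsCost_of_eq_zero hμ]
  · have hle := condLExp_le_of_forall_setLIntegral_le (obsField_le hmodel A n) (P := P)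
      (f := fun ω => ENNReal.ofReal μ *
        riskIntegrand X Q μ n (Function.update hbar n (hbar n)) ω)
      (g := fun ω => ENNReal.ofReal μ * riskIntegrand X Q μ n (Function.update hbar n g) ω)
      fun B hB => by
      rw [lintegral_const_mul' _ _ ENNReal.ofReal_ne_top,
        lintegral_const_mul' _ _ ENNReal.ofReal_ne_top, Function.update_eq_self]
      refine mul_le_mul_right ?_ _
      have := optimalRisk_le_expRisk hmodel hQ hγ hγ0 hS (hupd B hB) hμ
      rw [← hopt, setLIntegral_riskIntegrand_add hmodel hB, hsplit B hB] at this
      exact (ENNReal.add_le_add_iff_right (hcfin B hB)).1 this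
    filter_upwards [hle] with ω hω
    rw [rsCost_of_pos hμ hn, rsCost_of_pos hμ hn, EReal.coe_ennreal_le_coe_ennreal_iff]
    exact hω

/-! ### Solutions of the two problems -/

lemma isLEGSolution_filter (hmodel : IsSignalModel P X ε m K) (hQ : ∀ t, 1 ≤ t → 0 ≤ Q t)
    (hγ : IsGammaSolution K A Q μ n γ) (hγ0 : ∀ l, 1 ≤ l → l ≤ n → 0 ≤ γ l l)
    (hS : ∀ l, 1 ≤ l → l ≤ n → 0 < 1 + weight A Q μ l * γ l l)
    (hbar_sol : IsFilterSolution m A γ (obs A X ε) n hbar) :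
    IsLEGSolution P X (obs A X ε) Q μ n hbar := by
  refine ⟨hbar_sol.isObsAdapted hγ0, fun h hh => ?_⟩
  have hopt := expRisk_filter hmodel hγ hγ0 hS hbar_sol
  rcases lt_trichotomy μ 0 with hμ | hμ | hμ
  · rw [legCost_le_iff_of_neg hμ, hopt]
    exact expRisk_le_optimalRisk hmodel hQ hγ hγ0 hS hh hμ
  · rw [legCost_of_eq_zero hμ, legCost_of_eq_zero hμ]
  · rw [legCost_le_iff_of_pos hμ, hopt]
    exact optimalRisk_le_expRisk hmodel hQ hγ hγ0 hS hh hμ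

lemma isRSSolution_filter (hmodel : IsSignalModel P X ε m K) (hQ : ∀ t, 1 ≤ t → 0 ≤ Q t)
    (hγ : IsGammaSolution K A Q μ n γ) (hγ0 : ∀ l, 1 ≤ l → l ≤ n → 0 ≤ γ l l)
    (hS : ∀ l, 1 ≤ l → l ≤ n → 0 < 1 + weight A Q μ l * γ l l)
    (hbar_sol : IsFilterSolution m A γ (obs A X ε) n hbar) :
    IsRSSolution P X (obs A X ε) Q μ n hbar := fun t h1 h2 =>
  ⟨hbar_sol.isObsAdapted hγ0 t h1 h2, fun _ hg =>
    rsCost_filter_le hmodel hQ (hγ.mono h2) (fun l hl1 hl2 => hγ0 l hl1 (hl2.trans h2))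
      (fun l hl1 hl2 => hS l hl1 (hl2.trans h2)) (hbar_sol.mono h2) h1 hg⟩

lemma IsLEGSolution.ae_eq_filter (hmodel : IsSignalModel P X ε m K) (hQ : ∀ t, 1 ≤ t → 0 ≤ Q t)
    (hγ : IsGammaSolution K A Q μ n γ) (hγ0 : ∀ l, 1 ≤ l → l ≤ n → 0 ≤ γ l l)
    (hS : ∀ l, 1 ≤ l → l ≤ n → 0 < 1 + weight A Q μ l * γ l l)
    (hbar_sol : IsFilterSolution m A γ (obs A X ε) n hbar)
    (hh : IsLEGSolution P X (obs A X ε) Q μ n h) :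
    ∀ t, 1 ≤ t → t ≤ n → μ * Q t ≠ 0 → h t =ᵐ[P] hbar t := by
  intro t h1 h2 h3
  refine ae_eq_filter_of_expRisk_eq hmodel hQ hγ hγ0 hS hbar_sol hh.1 ?_ t h1 h2 h3
  have hle := hh.2 hbar (hbar_sol.isObsAdapted hγ0)
  have hopt := expRisk_filter hmodel hγ hγ0 hS hbar_sol
  rcases (left_ne_zero_of_mul h3).lt_or_gt with hμ | hμ
  · rw [legCost_le_iff_of_neg hμ, hopt] at hle
    exact le_antisymm (expRisk_le_optimalRisk hmodel hQ hγ hγ0 hS hh.1 hμ) hle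
  · rw [legCost_le_iff_of_pos hμ, hopt] at hle
    exact le_antisymm hle (optimalRisk_le_expRisk hmodel hQ hγ hγ0 hS hh.1 hμ)

/-- Comparison of conditional criteria implies comparison of the unconditional ones. -/
lemma legCost_le_of_rsCost_le (hmodel : IsSignalModel P X ε m K) (hn : 1 ≤ n) {g g' : Ω → ℝ}
    (hle : ∀ᵐ ω ∂P, rsCost P X (obs A X ε) Q μ h n g ω ≤ rsCost P X (obs A X ε) Q μ h n g' ω) :
    legCost P X Q μ n (Function.update h n g) ≤ legCost P X Q μ n (Function.update h n g') := by
  have hm := obsField_le hmodel A n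
  have hint : ∀ (c : ℝ) (u : ℕ → Ω → ℝ), ∫⁻ ω, condLExp (obsField (obs A X ε) n) P (fun ω =>
      ENNReal.ofReal c * riskIntegrand X Q μ n u ω) ω ∂P =
      ENNReal.ofReal c * expRisk P X Q μ n u := fun c u => by
    rw [lintegral_condLExp hm, lintegral_const_mul' _ _ ENNReal.ofReal_ne_top]; rfl
  rcases lt_trichotomy μ 0 with hμ | hμ | hμ
  · rw [legCost_of_neg hμ, legCost_of_neg hμ, EReal.neg_le_neg_iff,
      EReal.coe_ennreal_le_coe_ennreal_iff, ← hint, ← hint]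
    refine lintegral_mono_ae ?_
    filter_upwards [hle] with ω hω
    rwa [rsCost_of_neg hμ hn, rsCost_of_neg hμ hn, EReal.neg_le_neg_iff,
      EReal.coe_ennreal_le_coe_ennreal_iff] at hω
  · rw [legCost_of_eq_zero hμ, legCost_of_eq_zero hμ]
  · rw [legCost_of_pos hμ, legCost_of_pos hμ, EReal.coe_ennreal_le_coe_ennreal_iff,
      ← hint, ← hint]
    refine lintegral_mono_ae ?_
    filter_upwards [hle] with ω hω
    rwa [rsCost_of_pos hμ hn, rsCost_of_pos hμ hn, EReal.coe_ennreal_le_coe_ennreal_iff] at hω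

/-- By induction the earlier estimates agree with the filter where it matters. Testing the RS
problem against `hbar t` and integrating then makes `h` LEG-optimal with horizon t, where uniqueness
is known. -/
lemma IsRSSolution.ae_eq_filter (hmodel : IsSignalModel P X ε m K) (hQ : ∀ t, 1 ≤ t → 0 ≤ Q t)
    (hγ : IsGammaSolution K A Q μ T γ) (hγ0 : ∀ l, 1 ≤ l → l ≤ T → 0 ≤ γ l l)
    (hS : ∀ l, 1 ≤ l → l ≤ T → 0 < 1 + weight A Q μ l * γ l l)
    (hbar_sol : IsFilterSolution m A γ (obs A X ε) T hbar)
    (hh : IsRSSolution P X (obs A X ε) Q μ T h) :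
    ∀ t, 1 ≤ t → t ≤ T → μ * Q t ≠ 0 → h t =ᵐ[P] hbar t := by
  intro t
  induction t using Nat.strong_induction_on with
  | _ t ih =>
    intro h1 h2 h3
    have hγ' := hγ.mono h2
    have hγ0' : ∀ l, 1 ≤ l → l ≤ t → 0 ≤ γ l l := fun l hl1 hl2 => hγ0 l hl1 (hl2.trans h2)
    have hS' : ∀ l, 1 ≤ l → l ≤ t → 0 < 1 + weight A Q μ l * γ l l :=
      fun l hl1 hl2 => hS l hl1 (hl2.trans h2)
    have hsol' := hbar_sol.mono h2
    have hle := legCost_le_of_rsCost_le hmodel h1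
      ((hh t h1 h2).2 (hbar t) (hsol'.isObsAdapted hγ0' t h1 le_rfl))
    -- Replacing the earlier estimates by the filter costs nothing, by the induction hypothesis.
    rw [Function.update_eq_self, legCost_congr (h := Function.update h t (hbar t)) (h' := hbar)
      fun s hs1 hs2 hs3 => ?_] at hle
    · refine IsLEGSolution.ae_eq_filter hmodel hQ hγ' hγ0' hS' hsol'
        ⟨fun s hs1 hs2 => (hh s hs1 (hs2.trans h2)).1, fun h' hh' => hle.trans ?_⟩ t h1 le_rfl h3
      exact (isLEGSolution_filter hmodel hQ hγ' hγ0' hS' hsol').2 h' hh'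
    · rcases hs2.eq_or_lt with rfl | hs2
      · simp
      · rw [Function.update_of_ne hs2.ne]
        exact ih s hs2 hs1 (hs2.le.trans h2) hs3

/-- The solutions of the LEG problem are the adapted sequences which agree with the filter
wherever the criterion is not degenerate. -/
lemma isLEGSolution_iff (hmodel : IsSignalModel P X ε m K) (hQ : ∀ t, 1 ≤ t → 0 ≤ Q t)
    (hγ : IsGammaSolution K A Q μ T γ) (hγ0 : ∀ l, 1 ≤ l → l ≤ T → 0 ≤ γ l l)
    (hS : ∀ l, 1 ≤ l → l ≤ T → 0 < 1 + weight A Q μ l * γ l l)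
    (hbar_sol : IsFilterSolution m A γ (obs A X ε) T hbar) :
    IsLEGSolution P X (obs A X ε) Q μ T h ↔ IsObsAdapted (obs A X ε) T h ∧
      ∀ t, 1 ≤ t → t ≤ T → μ * Q t ≠ 0 → h t =ᵐ[P] hbar t := by
  refine ⟨fun hh => ⟨hh.1, hh.ae_eq_filter hmodel hQ hγ hγ0 hS hbar_sol⟩,
    fun hh => ⟨hh.1, fun h' hh' => ?_⟩⟩
  rw [legCost_congr hh.2]
  exact (isLEGSolution_filter hmodel hQ hγ hγ0 hS hbar_sol).2 h' hh'

/-- The solutions of the RS problem are the adapted sequences which agree with the filter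
wherever the criterion is not degenerate. -/
lemma isRSSolution_iff (hmodel : IsSignalModel P X ε m K) (hQ : ∀ t, 1 ≤ t → 0 ≤ Q t)
    (hγ : IsGammaSolution K A Q μ T γ) (hγ0 : ∀ l, 1 ≤ l → l ≤ T → 0 ≤ γ l l)
    (hS : ∀ l, 1 ≤ l → l ≤ T → 0 < 1 + weight A Q μ l * γ l l)
    (hbar_sol : IsFilterSolution m A γ (obs A X ε) T hbar) :
    IsRSSolution P X (obs A X ε) Q μ T h ↔ IsObsAdapted (obs A X ε) T h ∧
      ∀ t, 1 ≤ t → t ≤ T → μ * Q t ≠ 0 → h t =ᵐ[P] hbar t := by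
  refine ⟨fun hh => ⟨fun t h1 h2 => (hh t h1 h2).1,
    hh.ae_eq_filter hmodel hQ hγ hγ0 hS hbar_sol⟩, fun hh t h1 h2 => ⟨hh.1 t h1 h2,
    fun g hg => ?_⟩⟩
  have hH : ∀ s, 1 ≤ s → s < t → μ * Q s ≠ 0 → h s =ᵐ[P] hbar s :=
    fun s hs1 hs2 hs3 => hh.2 s hs1 (hs2.le.trans h2) hs3
  have e1 := rsCost_congr (X := X) (Y := obs A X ε) h1 hH (hh.2 t h1 h2)
  have e2 := rsCost_congr (X := X) (Y := obs A X ε) h1 hH fun _ => ae_eq_refl g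
  filter_upwards [e1, e2, (isRSSolution_filter hmodel hQ hγ hγ0 hS hbar_sol t h1 h2).2 g hg]
    with ω h3 h4 h5
  rwa [h3, h4]

end

end RiskFilter

theorem theorem3 {Ω : Type*} [MeasurableSpace Ω] (P : Measure Ω) [IsProbabilityMeasure P]
    (X ε : ℕ → Ω → ℝ) (m : ℕ → ℝ) (K : ℕ → ℕ → ℝ) (A Q : ℕ → ℝ) (μ : ℝ) (T : ℕ)
    (hmodel : RiskFilter.IsSignalModel P X ε m K)
    (hQ : ∀ t, 1 ≤ t → 0 ≤ Q t)
    (hC : RiskFilter.ConditionC K A Q μ T)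
    (γ : ℕ → ℕ → ℝ) (hγ : RiskFilter.IsGammaSolution K A Q μ T γ) :
    -- the equation for `h` has a solution,
    (∃ h : ℕ → Ω → ℝ, RiskFilter.IsFilterSolution m A γ (RiskFilter.obs A X ε) T h) ∧
    -- and any solution `h` of it
    (∀ h : ℕ → Ω → ℝ, RiskFilter.IsFilterSolution m A γ (RiskFilter.obs A X ε) T h →
      -- is the only one,
      (∀ h' : ℕ → Ω → ℝ, RiskFilter.IsFilterSolution m A γ (RiskFilter.obs A X ε) T h' →
        ∀ t, 1 ≤ t → t ≤ T → h' t = h t) ∧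
      -- solves the LEG filtering problem,
      RiskFilter.IsLEGSolution P X (RiskFilter.obs A X ε) Q μ T h ∧
      -- solves the RS filtering problem,
      RiskFilter.IsRSSolution P X (RiskFilter.obs A X ε) Q μ T h ∧
      -- and is, up to null sets, the only RS solution wherever the criterion is not degenerate.
      (∀ h' : ℕ → Ω → ℝ, RiskFilter.IsRSSolution P X (RiskFilter.obs A X ε) Q μ T h' →
        ∀ t, 1 ≤ t → t ≤ T → μ * Q t ≠ 0 → h' t =ᵐ[P] h t)) ∧
    -- The LEG and the RS filtering problems have the same solutions.
    (∀ h' : ℕ → Ω → ℝ, RiskFilter.IsLEGSolution P X (RiskFilter.obs A X ε) Q μ T h' ↔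
      RiskFilter.IsRSSolution P X (RiskFilter.obs A X ε) Q μ T h') := by
  obtain ⟨γ₀, -, huniq, -, hγ₀, hS₀⟩ := hC
  -- Uniqueness in the condition carries its sign properties over to the given γ.
  have hγ0 : ∀ l, 1 ≤ l → l ≤ T → 0 ≤ γ l l := fun l h1 h2 => by
    rw [huniq γ hγ l l h1 le_rfl h2]; exact hγ₀ l h1 h2
  have hS : ∀ l, 1 ≤ l → l ≤ T → 0 < 1 + RiskFilter.weight A Q μ l * γ l l := fun l h1 h2 => by
    rw [huniq γ hγ l l h1 le_rfl h2]; exact hS₀ l h1 h2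
  have hsol := RiskFilter.isFilterSolution_filterRec (m := m) (A := A)
    (Y := RiskFilter.obs A X ε) hγ0
  refine ⟨⟨_, hsol⟩, fun h hh => ⟨fun h' hh' => hh.unique hh' hγ0,
    RiskFilter.isLEGSolution_filter hmodel hQ hγ hγ0 hS hh,
    RiskFilter.isRSSolution_filter hmodel hQ hγ hγ0 hS hh,
    fun h' hh' => hh'.ae_eq_filter hmodel hQ hγ hγ0 hS hh⟩, fun h' => ?_⟩
  rw [RiskFilter.isLEGSolution_iff hmodel hQ hγ hγ0 hS hsol,
    RiskFilter.isRSSolution_iff hmodel hQ hγ hγ0 hS hsol]
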